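/- Let $q$ be a prime power and let $G\le \operatorname{PGL}_2(\mathbb{F}_q)$ be a subgroup. For $[A]\in \operatorname{PGL}_2(\mathbb{F}_q)$ with $A=\begin{pmatrix} a&b\\ c&d\end{pmatrix}$ and a nonzero $f\in\mathbb{F}_q[x]$ put $$[A]\ast f(x)=\lambda_{A,f}\,(cx+d)^{\deg f} f\!\left(\frac{ax+b}{cx+d}\right),$$ where $\lambda_{A,f}\in\mathbb{F}_q^{*}$ makes the result monic, and $G\ast f=\{[A]\ast f\mid [A]\in G\}$. Let $\mathcal{I}_q^n$ be the set of monic irreducible polynomials of degree $n$ in $\mathbb{F}_q[x]$, let $\mathcal{I}_q=\bigcup_{n\ge1}\mathcal{I}_q^n$, let $N_q(n)=|\mathcal{I}_q^n|$, and let $$\omega_G(n,k)=\bigl|\{G\ast r\mid r\in\mathcal{I}_q^n,\ |G\ast r|=k\}\bigr|.$$ Let $\mathcal{I}_q^G$ be the set of all $f\in\mathcal{I}_q$ that have no root in the orbit $\{a/c \mid [A]\in G\}\subseteq \mathbb{F}_q\cup\{\infty\}$ of $\infty$ under $G$. A quotient map for $G$ is a rational function $Q=g/h$ with $g,h\in\mathbb{F}_q[x]$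 coprime, $h\ne 0$, $g$ monic, $\deg h<\deg g=|G|$, such that $\mathbb{F}_q(Q)$ is the field of all $R\in\mathbb{F}_q(x)$ with $R\!\left(\frac{ax+b}{cx+d}\right)=R(x)$ for all $[A]\in G$. Quotient maps exist. For $F\in\mathcal{I}_q$ put $F^{Q}=h^{\deg F}F(g/h)$, and let $d(G)$ be the largest degree of an $F\in\mathcal{I}_q$ for which there are $r\in\mathcal{I}_q^G$ and an integer $k>1$ with $F^{Q}=\bigl(\prod_{t\in G\ast r}t\bigr)^k$, and $d(G)=0$ if there is no such $F$; this number does not depend on the choice of the quotient map $Q$ for $G$. Then for every integer $m>d(G)$ $$N_q(m)=\sum_{k\,\mid\,|G|}\omega_G\!\left(m\cdot\frac{|G|}{k},\,k\right).$$ -/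

import Mathlib

open scoped Polynomial MatrixGroups

noncomputable section

namespace MobiusOrbits

variable {K : Type*} [Field K]

/-- The transform `F^{g/h} = h ^ (deg F) * F (g / h)`, a polynomial:
if `F = ∑ aᵢ xⁱ` has degree `n`, it equals `∑ aᵢ gⁱ h^(n - i)`. -/
def ratTransform (F g h : K[X]) : K[X] :=
  ∑ i ∈ Finset.range (F.natDegree + 1),
    Polynomial.C (F.coeff i) * g ^ i * h ^ (F.natDegree - i)

/-- The polynomial `a x + b`, where `a, b` is the first row of `A`. -/
def mobNum (A : GL (Fin 2) K) : K[X] :=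
  Polynomial.C (A 0 0) * Polynomial.X + Polynomial.C (A 0 1)

/-- The polynomial `c x + d`, where `c, d` is the second row of `A`. -/
def mobDen (A : GL (Fin 2) K) : K[X] :=
  Polynomial.C (A 1 0) * Polynomial.X + Polynomial.C (A 1 1)

/-- The linear rational function `[A] ∘ x = (a x + b) / (c x + d)`. -/
def mobius (A : GL (Fin 2) K) : RatFunc K :=
  algebraMap K[X] (RatFunc K) (mobNum A) / algebraMap K[X] (RatFunc K) (mobDen A)

/-- `[A] ∗ f = lam * (c x + d) ^ (deg f) * f ((a x + b) / (c x + d))`, where the nonzero scalar `lam`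
makes the result monic. It only depends on the class of `A` modulo scalars. -/
def starAct (A : GL (Fin 2) K) (f : K[X]) : K[X] :=
  Polynomial.C (ratTransform f (mobNum A) (mobDen A)).leadingCoeff⁻¹ *
    ratTransform f (mobNum A) (mobDen A)

/-- `G ∗ r = {[A] ∗ r | [A] ∈ G}`. -/
def orbit (G : Subgroup PGL(2, K)) (r : K[X]) : Set K[X] :=
  {t | ∃ A : GL (Fin 2) K, Matrix.ProjGenLinGroup.mk A ∈ G ∧ t = starAct A r}

/-- The set of monic irreducible polynomials of degree `n`. -/
def irr (K : Type*) [Field K] (n : ℕ) : Set K[X] :=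
  {f | f.Monic ∧ Irreducible f ∧ f.natDegree = n}

/-- The monic irreducible polynomials `f` with `f(α) ≠ 0` for all `α` in the orbit `G ∘ ∞`.
The finite points of that orbit are the `a / c` with `[A] ∈ G` and `c ≠ 0`; the point `∞` imposes
no condition, since `f(∞) = ∞` for nonconstant `f`. -/
def irrNR (G : Subgroup PGL(2, K)) : Set K[X] :=
  {f | f.Monic ∧ Irreducible f ∧
    ∀ A : GL (Fin 2) K, Matrix.ProjGenLinGroup.mk A ∈ G → A 1 0 ≠ 0 →
      f.eval (A 0 0 / A 1 0) ≠ 0}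

/-- `Q` is `G`-invariant: `Q ([A] ∘ x) = Q (x)` for all `[A] ∈ G`. -/
def IsInvariant (G : Subgroup PGL(2, K)) (Q : RatFunc K) : Prop :=
  ∀ A : GL (Fin 2) K, Matrix.ProjGenLinGroup.mk A ∈ G →
    RatFunc.eval (algebraMap K (RatFunc K)) (mobius A) Q = Q

/-- `g / h` is a quotient map for `G`: a reduced fraction with monic numerator of degree `|G|`
and nonzero denominator of smaller degree which generates, over `K`, the field of all `G`-invariant
rational functions. -/
structure IsQuotientMap (G : Subgroup PGL(2, K)) (g h : K[X]) : Prop where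
  coprime : IsCoprime g h
  monic : g.Monic
  natDegree_num : g.natDegree = Nat.card G
  den_ne_zero : h ≠ 0
  natDegree_den : h.natDegree < g.natDegree
  generates : ∀ R : RatFunc K, IsInvariant G R ↔
    R ∈ IntermediateField.adjoin K
      {algebraMap K[X] (RatFunc K) g / algebraMap K[X] (RatFunc K) h}

/-- `d(Q)` for `Q = g / h`: the largest degree of a monic irreducible `F` such that `F^Q` is the
`k`-th power, for some `k > 1`, of the product of the members of some orbit `G ∗ r`;
it is `0` if there is no such `F`. -/
def dQuot (G : Subgroup PGL(2, K)) (g h : K[X]) : ℕ :=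
  sSup {n | ∃ F ∈ irr K n, ∃ r ∈ irrNR G, ∃ k : ℕ, 1 < k ∧
    ratTransform F g h = (∏ᶠ t ∈ orbit G r, t) ^ k}

/-- `d(G)`: the value of `d(Q)` at the quotient maps `Q` for `G` (for finite `K`, quotient maps
exist and all of them have the same `d(Q)`, so that the infimum is this common value). -/
def dGroup (G : Subgroup PGL(2, K)) : ℕ :=
  sInf {n | ∃ g h : K[X], IsQuotientMap G g h ∧ n = dQuot G g h}

/-- `N(n)`: the number of monic irreducible polynomials of degree `n`. -/
def numIrr (K : Type*) [Field K] (n : ℕ) : ℕ := (irr K n).ncard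

/-- `ω_G(n, k)`: the number of sets `G ∗ r` with `r` monic irreducible of degree `n` and
`|G ∗ r| = k`. -/
def omega (G : Subgroup PGL(2, K)) (n k : ℕ) : ℕ :=
  {O : Set K[X] | (∃ r ∈ irr K n, O = orbit G r) ∧ O.ncard = k}.ncard

end MobiusOrbits

end

/-!
Write `n = |G|`, let `g / h` be a quotient map for `G`, `Q = g / h`, and let `L` be an algebraic
closure of `K`.

*The fibers of `Q` are the orbits of `G`.* Since `Q` is `G`-invariant, the `n` distinct conjugates
`[A] ∘ x` of `x` are roots of `g(T) - Q(x) h(T)`, which is monic of degree `n` in `T`. Hence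
`g(T) - Q(x) h(T) = ∏_{[A] ∈ G} (T - [A] ∘ x)`. Clearing denominators and specializing `x` to
`γ ∈ L` shows that `γ` lies outside the orbit of infinity if and only if `h(γ) ≠ 0`, and that then
`g - Q(γ) h = ∏_{[A] ∈ G} (T - [A] ∘ γ)` (`IsQuotientMap.fiber`).

*Transforms are powers of orbit products.* If `γ` lies outside the orbit of infinity, `F` is the
minimal polynomial of `Q(γ)` and `r` that of `γ`, then `F^Q` is the product of the members of
`G ∗ r`, raised to the order of the stabilizer of `γ`. Both sides are monic, and they have the same
roots in `L` with the same multiplicities, because two points have conjugate values under `Q` if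
and only if they differ by `G` and a `K`-automorphism of `L`
(`IsQuotientMap.ratTransform_minpoly`).

*Counting.* Every monic irreducible `F` is the minimal polynomial of some `Q(γ)`. If
`deg F > d(G)`, the stabilizer of `γ` is trivial, so `F^Q` is the product of an orbit `G ∗ r`, and
comparing degrees gives `|G ∗ r| * deg r = n * deg F`. Sending `F` to the set of monic irreducible
factors of `F^Q` is the desired bijection (`IsQuotientMap.injOn_irrFactors`,
`IsQuotientMap.image_irrFactors`). That `d(G)` is a genuine maximum uses that only finitely many
points have a nontrivial stabilizer, each being a root of a nonzero polynomial of degree at most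
two (`finite_ramified`). The polynomials `x - a / c` with `a / c` in the orbit of infinity would be
surplus members of the right-hand side; they contribute only if `m = 1` and the orbit of infinity
is regular, and then a fixed point of a nontrivial element of `G` lies outside that orbit and
forces `d(G) ≥ 1` (`exists_ramified_of_infty_regular`).

*Quotient maps exist* (`exists_isQuotientMap`). By Artin's theorem the invariant field has degree
`n` below `K(x)`, by Lüroth's theorem it is generated by one function, and a linear fractional
change of the generator moves a pole to infinity.
-/

noncomputable section

namespace MobiusOrbits

open Polynomial
open Matrix.ProjGenLinGroup (mk mk_surjective mk_eq_mk_iff)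

variable {K : Type*} [Field K]

/-! ### Linear fractional maps on the points of an extension -/

section Points
variable {L : Type*} [Field L] [Algebra K L]

/-- The value `(a γ + b) / (c γ + d)` at a point `γ` of an extension field. Where the denominator
vanishes it is the junk value `0`; it is used only at points of `regPts`, or where the denominator
is assumed not to vanish. -/
def mobPt (A : GL (Fin 2) K) (γ : L) : L := aeval γ (mobNum A) / aeval γ (mobDen A)

lemma aeval_mobNum (A : GL (Fin 2) K) (γ : L) :
    aeval γ (mobNum A) = algebraMap K L (A 0 0) * γ + algebraMap K L (A 0 1) := by
  simp [mobNum]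

lemma aeval_mobDen (A : GL (Fin 2) K) (γ : L) :
    aeval γ (mobDen A) = algebraMap K L (A 1 0) * γ + algebraMap K L (A 1 1) := by
  simp [mobDen]

lemma aeval_mobNum_mul (A B : GL (Fin 2) K) {γ : L} (hB : aeval γ (mobDen B) ≠ 0) :
    aeval γ (mobNum (A * B)) = aeval (mobPt B γ) (mobNum A) * aeval γ (mobDen B) := by
  rw [mobPt]
  simp only [aeval_mobNum, aeval_mobDen] at *
  simp only [Units.val_mul, Matrix.mul_apply, Fin.sum_univ_two, map_add, map_mul]
  field_simp
  ring

lemma aeval_mobDen_mul (A B : GL (Fin 2) K) {γ : L} (hB : aeval γ (mobDen B) ≠ 0) :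
    aeval γ (mobDen (A * B)) = aeval (mobPt B γ) (mobDen A) * aeval γ (mobDen B) := by
  rw [mobPt]
  simp only [aeval_mobNum, aeval_mobDen] at *
  simp only [Units.val_mul, Matrix.mul_apply, Fin.sum_univ_two, map_add, map_mul]
  field_simp
  ring

lemma mobPt_mul (A B : GL (Fin 2) K) {γ : L} (hB : aeval γ (mobDen B) ≠ 0) :
    mobPt (A * B) γ = mobPt A (mobPt B γ) := by
  rw [mobPt, aeval_mobNum_mul A B hB, aeval_mobDen_mul A B hB, mul_div_mul_right _ _ hB]; rfl

lemma det_ne_zero (A : GL (Fin 2) K) : A 0 0 * A 1 1 - A 0 1 * A 1 0 ≠ 0 := by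
  have h := A.isUnit.map Matrix.detMonoidHom
  simpa [Matrix.det_fin_two] using h.ne_zero

lemma mobDen_ne_zero (A : GL (Fin 2) K) : mobDen A ≠ 0 := by
  intro h
  have h1 : A 1 0 = 0 := by simpa [mobDen] using congrArg (coeff · 1) h
  have h0 : A 1 1 = 0 := by simpa [mobDen] using congrArg (coeff · 0) h
  exact det_ne_zero A (by simp [h1, h0])

lemma mobNum_mul_scalar (A : GL (Fin 2) K) (u : Kˣ) :
    mobNum (A * .scalar (Fin 2) u) = C (u : K) * mobNum A := by
  simp only [mobNum, Units.val_mul, Matrix.mul_apply, Fin.sum_univ_two]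
  simp [Matrix.scalar_apply]
  ring

lemma mobDen_mul_scalar (A : GL (Fin 2) K) (u : Kˣ) :
    mobDen (A * .scalar (Fin 2) u) = C (u : K) * mobDen A := by
  simp only [mobDen, Units.val_mul, Matrix.mul_apply, Fin.sum_univ_two]
  simp [Matrix.scalar_apply]
  ring

lemma mobPt_eq_of_mk_eq {A B : GL (Fin 2) K} (h : mk A = mk B) (γ : L) :
    mobPt A γ = mobPt B γ := by
  obtain ⟨u, rfl⟩ := mk_eq_mk_iff.1 h
  have hu : algebraMap K L u ≠ 0 := by simp
  rw [mobPt, mobPt, mobNum_mul_scalar, mobDen_mul_scalar, map_mul, map_mul, aeval_C,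
    mul_div_mul_left _ _ hu]

@[simp] lemma mobPt_one (γ : L) : mobPt (1 : GL (Fin 2) K) γ = γ := by
  simp [mobPt, mobNum, mobDen]

/-- The map `A` has no common zero of numerator and denominator, its determinant being nonzero. -/
lemma aeval_mobNum_ne_zero (A : GL (Fin 2) K) {γ : L} (h : aeval γ (mobDen A) = 0) :
    aeval γ (mobNum A) ≠ 0 := by
  intro h'
  rw [aeval_mobNum] at h'
  rw [aeval_mobDen] at h
  have hd := (algebraMap K L).injective.ne (det_ne_zero A)
  simp only [map_sub, map_mul, map_zero] at hd
  by_cases hc : algebraMap K L (A 1 0) = 0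
  · have : algebraMap K L (A 1 1) = 0 := by simpa [hc] using h
    simp [hc, this] at hd
  · apply hd
    have : algebraMap K L (A 1 0) * (algebraMap K L (A 0 0) * algebraMap K L (A 1 1) -
      algebraMap K L (A 0 1) * algebraMap K L (A 1 0)) = 0 := by
      linear_combination algebraMap K L (A 0 0) * algebraMap K L (A 1 0) * h
        - algebraMap K L (A 1 0) * algebraMap K L (A 1 0) * h'
    exact (mul_eq_zero.1 this).resolve_left hc

/-- The points of `L` outside the orbit of infinity: no member of `G` sends them to infinity.
The group `G` acts on them by linear fractional maps. -/
def regPts (G : Subgroup PGL(2, K)) (L : Type*) [Field L] [Algebra K L] : Set L :=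
  {γ | ∀ A : GL (Fin 2) K, mk A ∈ G → aeval γ (mobDen A) ≠ 0}

variable {G : Subgroup PGL(2, K)}

lemma mobPt_mem_regPts {A : GL (Fin 2) K} (hA : mk A ∈ G) {γ : L} (hγ : γ ∈ regPts G L) :
    mobPt A γ ∈ regPts G L := by
  intro B hB h0
  have := hγ (B * A) (by rw [map_mul]; exact G.mul_mem hB hA)
  rw [aeval_mobDen_mul _ _ (hγ A hA), h0, zero_mul] at this
  exact this rfl

/-- A chosen matrix in a given class of `PGL(2, K)`. -/
def rep (p : PGL(2, K)) : GL (Fin 2) K := Function.surjInv mk_surjective p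

@[simp] lemma mk_rep (p : PGL(2, K)) : mk (rep p) = p := Function.surjInv_eq mk_surjective p

instance : SMul G (regPts G L) where
  smul p γ := ⟨mobPt (rep (p : PGL(2, K))) (γ : L),
    mobPt_mem_regPts (by rw [mk_rep]; exact p.2) γ.2⟩

lemma coe_smul (p : G) (γ : regPts G L) :
    ((p • γ : regPts G L) : L) = mobPt (rep (p : PGL(2, K))) (γ : L) := rfl

lemma coe_mk_smul {A : GL (Fin 2) K} (hA : mk A ∈ G) (γ : regPts G L) :
    (((⟨mk A, hA⟩ : G) • γ : regPts G L) : L) = mobPt A (γ : L) :=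
  mobPt_eq_of_mk_eq (mk_rep _) _

instance : MulAction G (regPts G L) where
  one_smul γ := Subtype.ext ((mobPt_eq_of_mk_eq (by simp) _).trans (mobPt_one (K := K) (γ : L)))
  mul_smul p q γ := by
    apply Subtype.ext
    rw [coe_smul, coe_smul, coe_smul, ← mobPt_mul _ _ (γ.2 _ (by rw [mk_rep]; exact q.2))]
    exact mobPt_eq_of_mk_eq (by simp) _

end Points

/-! ### The transform of a polynomial under a fraction -/

section RatTransform
variable {L : Type*} [Field L]

/-- Under a homomorphism `φ` to a field, `F^{g/h}` becomes `φ(h) ^ (deg F) * F(φ(g) / φ(h))`. -/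
lemma map_ratTransform_eq [Algebra K L] (φ : K[X] →ₐ[K] L) (F g h : K[X]) (hh : φ h ≠ 0) :
    φ (ratTransform F g h) = φ h ^ F.natDegree * aeval (φ g / φ h) F := by
  rw [ratTransform, map_sum, aeval_eq_sum_range, Finset.mul_sum]
  refine Finset.sum_congr rfl fun i hi => ?_
  rw [map_mul, map_mul, map_pow, map_pow, ← Polynomial.algebraMap_eq, AlgHom.commutes,
    Algebra.smul_def]
  have : i ≤ F.natDegree := Nat.lt_succ_iff.1 (Finset.mem_range.1 hi)
  rw [div_pow, ← Nat.sub_add_cancel this, pow_add, Nat.add_sub_cancel]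
  field_simp

lemma ratTransform_map (φ : K →+* L) (F g h : K[X]) :
    (ratTransform F g h).map φ = ratTransform (F.map φ) (g.map φ) (h.map φ) := by
  simp [ratTransform, Polynomial.map_sum]

lemma algebraMap_ratTransform (F g h : K[X]) (hh : h ≠ 0) :
    algebraMap K[X] (RatFunc K) (ratTransform F g h) = algebraMap K[X] (RatFunc K) h ^ F.natDegree *
      aeval (algebraMap K[X] (RatFunc K) g / algebraMap K[X] (RatFunc K) h) F :=
  map_ratTransform_eq (IsScalarTower.toAlgHom K K[X] (RatFunc K)) F g h
    (RatFunc.algebraMap_ne_zero hh)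

/-- The transform of a split polynomial with roots `a` is the product of the `g - a h`. -/
lemma ratTransform_multiset_prod (s : Multiset K) (g h : K[X]) (hh : h ≠ 0) :
    ratTransform (s.map fun a => X - C a).prod g h = (s.map fun a => g - C a * h).prod := by
  apply RatFunc.algebraMap_injective K
  have hh' := RatFunc.algebraMap_ne_zero hh
  rw [algebraMap_ratTransform _ _ _ hh, natDegree_multiset_prod_X_sub_C_eq_card]
  induction s using Multiset.induction_on with
  | empty => simp
  | cons a s ih =>
    simp only [Multiset.map_cons, Multiset.prod_cons, map_mul, Multiset.card_cons] at ih ⊢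
    rw [← ih]
    simp only [map_sub, aeval_X, aeval_C, map_mul, RatFunc.algebraMap_C,
      ← RatFunc.algebraMap_eq_C]
    field_simp
    ring

lemma natDegree_ratTransform_le (F : K[X]) {g h : K[X]} {d : ℕ} (hg : g.natDegree ≤ d)
    (hh : h.natDegree ≤ d) : (ratTransform F g h).natDegree ≤ F.natDegree * d := by
  refine natDegree_sum_le_of_forall_le _ _ fun i hi => ?_
  have hi' : i ≤ F.natDegree := Nat.lt_succ_iff.1 (Finset.mem_range.1 hi)
  rw [mul_assoc]
  refine (natDegree_C_mul_le _ _).trans (natDegree_mul_le.trans ?_)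
  calc _ ≤ i * d + (F.natDegree - i) * d := by
        gcongr
        · exact natDegree_pow_le.trans (by gcongr)
        · exact natDegree_pow_le.trans (by gcongr)
    _ = F.natDegree * d := by rw [← add_mul, Nat.add_sub_cancel' hi']

end RatTransform

/-! ### The action on minimal polynomials -/

section Mobius

lemma mobius_eq_mobPt (A : GL (Fin 2) K) : mobius A = mobPt A (RatFunc.X : RatFunc K) := by
  rw [mobius, mobPt, RatFunc.aeval_X_left_eq_algebraMap, RatFunc.aeval_X_left_eq_algebraMap]

lemma aeval_X_mobDen_ne_zero (A : GL (Fin 2) K) :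
    aeval (RatFunc.X : RatFunc K) (mobDen A) ≠ 0 := by
  rw [RatFunc.aeval_X_left_eq_algebraMap]
  exact RatFunc.algebraMap_ne_zero (mobDen_ne_zero A)

lemma X_mem_regPts (G : Subgroup PGL(2, K)) : (RatFunc.X : RatFunc K) ∈ regPts G (RatFunc K) :=
  fun A _ => aeval_X_mobDen_ne_zero A

/-- A fractional linear expression in an algebraic element is algebraic, and `X` is one in
`mobius A`. -/
lemma transcendental_mobius (A : GL (Fin 2) K) : Transcendental K (mobius A) := by
  intro h
  have h1 : ∀ a b : K, IsAlgebraic K (algebraMap K _ a * mobius A + algebraMap K _ b) := fun a b =>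
    ((isAlgebraic_algebraMap a).mul h).add (isAlgebraic_algebraMap b)
  apply RatFunc.transcendental_X (K := K)
  have h2 : mobPt A⁻¹ (mobius A) = RatFunc.X := by
    rw [mobius_eq_mobPt, ← mobPt_mul _ _ (aeval_X_mobDen_ne_zero A), inv_mul_cancel, mobPt_one]
  rw [← h2, mobPt, aeval_mobNum, aeval_mobDen, div_eq_mul_inv]
  exact (h1 _ _).mul (h1 _ _).inv

end Mobius

lemma ratTransform_mob_ne_zero (A : GL (Fin 2) K) {f : K[X]} (hf : f ≠ 0) :
    ratTransform f (mobNum A) (mobDen A) ≠ 0 := by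
  intro h
  have := algebraMap_ratTransform f (mobNum A) (mobDen A) (mobDen_ne_zero A)
  rw [h, map_zero] at this
  rcases mul_eq_zero.1 this.symm with h1 | h1
  · exact RatFunc.algebraMap_ne_zero (mobDen_ne_zero A) (eq_zero_of_pow_eq_zero h1)
  · exact hf ((transcendental_iff.1 (transcendental_mobius A)) f h1)

section Minpoly
variable {L : Type*} [Field L] [Algebra K L]
variable {G : Subgroup PGL(2, K)}

lemma aeval_ratTransform_mob (A : GL (Fin 2) K) (f : K[X]) {δ : L}
    (h : aeval δ (mobDen A) ≠ 0) : aeval δ (ratTransform f (mobNum A) (mobDen A)) =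
      aeval δ (mobDen A) ^ f.natDegree * aeval (mobPt A δ) f :=
  map_ratTransform_eq (aeval δ) f _ _ h

lemma natDegree_mob_le (A : GL (Fin 2) K) (f : K[X]) :
    (ratTransform f (mobNum A) (mobDen A)).natDegree ≤ f.natDegree := by
  have := natDegree_ratTransform_le f (d := 1) (g := mobNum A) (h := mobDen A)
    natDegree_linear_le natDegree_linear_le
  rwa [mul_one] at this

variable [Algebra.IsAlgebraic K L]

lemma natDegree_minpoly_mobPt_le (A : GL (Fin 2) K) {δ : L} (h : aeval δ (mobDen A) ≠ 0) :
    (minpoly K δ).natDegree ≤ (minpoly K (mobPt A δ)).natDegree := by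
  have hne := minpoly.ne_zero (Algebra.IsIntegral.isIntegral (R := K) (mobPt A δ))
  refine le_trans (natDegree_le_of_dvd (minpoly.dvd K δ ?_) (ratTransform_mob_ne_zero A hne))
    (natDegree_mob_le A _)
  rw [aeval_ratTransform_mob A _ h, minpoly.aeval, mul_zero]

lemma natDegree_minpoly_smul (p : G) (γ : regPts G L) :
    (minpoly K ((p • γ : regPts G L) : L)).natDegree = (minpoly K (γ : L)).natDegree := by
  have key : ∀ (p : G) (γ : regPts G L), (minpoly K (γ : L)).natDegree ≤
      (minpoly K ((p • γ : regPts G L) : L)).natDegree := fun p γ =>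
    natDegree_minpoly_mobPt_le _ (γ.2 _ (by rw [mk_rep]; exact p.2))
  refine le_antisymm ?_ (key p γ)
  simpa using key p⁻¹ (p • γ)

/-- On minimal polynomials of points outside the orbit of infinity, `[A] ∗ ·` is the action of the
inverse of `[A]` on the points. -/
lemma starAct_minpoly {A : GL (Fin 2) K} (hA : mk A ∈ G) (γ : regPts G L) :
    starAct A (minpoly K (γ : L)) =
      minpoly K (((⟨mk A, hA⟩ : G)⁻¹ • γ : regPts G L) : L) := by
  set p : G := ⟨mk A, hA⟩
  set δ := p⁻¹ • γ
  have hγ : γ = p • δ := by simp [δ]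
  have hγ' : (γ : L) = mobPt A (δ : L) := by rw [hγ]; exact coe_mk_smul hA δ
  have hne := minpoly.ne_zero (Algebra.IsIntegral.isIntegral (R := K) (γ : L))
  have hR := ratTransform_mob_ne_zero A hne
  have hroot : aeval (δ : L) (ratTransform (minpoly K (γ : L)) (mobNum A) (mobDen A)) = 0 := by
    rw [aeval_ratTransform_mob A _ (δ.2 A hA), ← hγ', minpoly.aeval, mul_zero]
  have hdvd := minpoly.dvd K _ hroot
  rw [starAct, mul_comm]
  refine (eq_of_monic_of_dvd_of_natDegree_le
    (minpoly.monic (Algebra.IsIntegral.isIntegral (R := K) (δ : L)))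
    (monic_mul_leadingCoeff_inv hR) (hdvd.mul_right _) ?_)
  refine natDegree_mul_le.trans ?_
  rw [natDegree_C, add_zero, natDegree_minpoly_smul]
  exact natDegree_mob_le A _

lemma orbit_minpoly (γ : regPts G L) :
    orbit G (minpoly K (γ : L)) = Set.range fun p : G => minpoly K ((p • γ : regPts G L) : L) := by
  ext t
  constructor
  · rintro ⟨A, hA, rfl⟩
    exact ⟨_, (starAct_minpoly hA γ).symm⟩
  · rintro ⟨p, rfl⟩
    have hm : mk (rep ((p⁻¹ : G) : PGL(2, K))) ∈ G := by rw [mk_rep]; exact (p⁻¹).2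
    refine ⟨rep ((p⁻¹ : G) : PGL(2, K)), hm, ?_⟩
    rw [starAct_minpoly hm]
    congr 3
    rw [eq_comm, inv_eq_iff_eq_inv]
    exact Subtype.ext (by simp)

end Minpoly

/-! ### Fixed points of linear fractional maps -/

section FixPoly

/-- The polynomial `c x² + (d - a) x - b`, whose roots are the finite fixed points of `A`. -/
def fixPoly (A : GL (Fin 2) K) : K[X] := C (A 1 0) * X ^ 2 + C (A 1 1 - A 0 0) * X + C (-A 0 1)

lemma aeval_fixPoly_eq_zero_iff {L : Type*} [Field L] [Algebra K L] (A : GL (Fin 2) K) {γ : L}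
    (h : aeval γ (mobDen A) ≠ 0) : aeval γ (fixPoly A) = 0 ↔ mobPt A γ = γ := by
  rw [mobPt, div_eq_iff h, aeval_mobNum, aeval_mobDen, fixPoly]
  simp only [map_add, map_mul, aeval_C, map_pow, aeval_X, map_sub, map_neg]
  constructor <;> intro h <;> linear_combination -h

lemma mk_eq_one_of_entries {A : GL (Fin 2) K} (h0 : A 1 0 = 0) (h1 : A 0 1 = 0)
    (h2 : A 1 1 = A 0 0) : mk A = 1 := by
  have hd := det_ne_zero A
  have ha : A 0 0 ≠ 0 := by
    intro ha
    simp [ha, h1] at hd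
  have : (1 : GL (Fin 2) K) * .scalar (Fin 2) (Units.mk0 _ ha) = A := by
    ext i j
    fin_cases i <;> fin_cases j <;> simp [h0, h1, h2]
  rw [← map_one (mk : GL (Fin 2) K →* PGL(2, K)), eq_comm]
  exact mk_eq_mk_iff.2 ⟨_, this⟩

lemma mk_eq_one_of_fixPoly_eq_zero {A : GL (Fin 2) K} (h : fixPoly A = 0) : mk A = 1 := by
  apply mk_eq_one_of_entries
  · simpa [fixPoly] using congrArg (coeff · 2) h
  · simpa [fixPoly] using congrArg (coeff · 0) h
  · simpa [fixPoly, sub_eq_zero] using congrArg (coeff · 1) h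

lemma mk_eq_one_of_mobius_eq_X {A : GL (Fin 2) K} (h : mobius A = RatFunc.X) : mk A = 1 := by
  apply mk_eq_one_of_fixPoly_eq_zero
  rw [mobius_eq_mobPt, ← aeval_fixPoly_eq_zero_iff A (aeval_X_mobDen_ne_zero A),
    RatFunc.aeval_X_left_eq_algebraMap] at h
  exact RatFunc.algebraMap_injective K (h.trans (map_zero _).symm)

end FixPoly

/-! ### The invariant field and the existence of quotient maps -/

section Action

/-- The substitution `R ↦ R ([A] ∘ x)`, an endomorphism of `K(x)` because `[A] ∘ x` is
transcendental. -/
def mobSubst (A : GL (Fin 2) K) : RatFunc K →ₐ[K] RatFunc K :=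
  RatFunc.liftAlgHom (aeval (mobius A)) fun p hp => by
    rw [Submonoid.mem_comap, mem_nonZeroDivisors_iff_ne_zero]
    exact fun h => nonZeroDivisors.ne_zero hp
      ((transcendental_iff.1 (transcendental_mobius A)) p h)

lemma mobSubst_apply (A : GL (Fin 2) K) (R : RatFunc K) :
    mobSubst A R = aeval (mobius A) R.num / aeval (mobius A) R.denom :=
  RatFunc.liftAlgHom_apply _ _ _

lemma mobSubst_algebraMap (A : GL (Fin 2) K) (p : K[X]) :
    mobSubst A (algebraMap K[X] (RatFunc K) p) = aeval (mobius A) p := by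
  simp [mobSubst_apply]

lemma mobSubst_X (A : GL (Fin 2) K) : mobSubst A RatFunc.X = mobius A := by
  simp [mobSubst_apply]

/-- The evaluation in the definition of invariance involves no junk value: it is the
substitution homomorphism. -/
lemma eval_mobius (A : GL (Fin 2) K) (R : RatFunc K) :
    RatFunc.eval (algebraMap K (RatFunc K)) (mobius A) R = mobSubst A R := by
  rw [mobSubst_apply]; rfl

lemma mobSubst_mobius (A B : GL (Fin 2) K) : mobSubst A (mobius B) = mobius (B * A) := by
  rw [mobius_eq_mobPt (B * A), mobPt_mul _ _ (aeval_X_mobDen_ne_zero A), ← mobius_eq_mobPt,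
    mobius, map_div₀, mobSubst_algebraMap, mobSubst_algebraMap, mobPt]

lemma mobSubst_mobSubst (A B : GL (Fin 2) K) (R : RatFunc K) :
    mobSubst A (mobSubst B R) = mobSubst (B * A) R := by
  rw [mobSubst_apply B, mobSubst_apply (B * A), map_div₀, ← aeval_algHom_apply,
    ← aeval_algHom_apply, mobSubst_mobius]

lemma mobSubst_of_mk_eq_one {A : GL (Fin 2) K} (h : mk A = 1) (R : RatFunc K) :
    mobSubst A R = R := by
  have : mobius A = RatFunc.X := by
    rw [mobius_eq_mobPt, mobPt_eq_of_mk_eq (B := 1) (by simpa using h), mobPt_one]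
  rw [mobSubst_apply, this, RatFunc.aeval_X_left_eq_algebraMap,
    RatFunc.aeval_X_left_eq_algebraMap, RatFunc.num_div_denom]

/-- The left action of `PGL(2, K)` on `K(x)`, in which `[A]` acts by substituting
`[A]⁻¹ ∘ x`; the inverse makes it a homomorphism, as substitution reverses products. -/
def substHom : PGL(2, K) →* (RatFunc K →+* RatFunc K) :=
  Matrix.ProjGenLinGroup.lift
    { toFun := fun A => (mobSubst A⁻¹ : RatFunc K →+* RatFunc K)
      map_one' := RingHom.ext fun R => mobSubst_of_mk_eq_one (by simp) R
      map_mul' := fun A B => RingHom.ext fun R => by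
        change mobSubst _ R = mobSubst _ (mobSubst _ R)
        rw [mobSubst_mobSubst, mul_inv_rev] }
    (MonoidHom.ext fun u => RingHom.ext fun R => mobSubst_of_mk_eq_one (by simp) R)

lemma substHom_mk (A : GL (Fin 2) K) (R : RatFunc K) : substHom (mk A) R = mobSubst A⁻¹ R := rfl

lemma isInvariant_iff (G : Subgroup PGL(2, K)) (R : RatFunc K) :
    IsInvariant G R ↔ ∀ p ∈ G, substHom p R = R := by
  constructor
  · intro h p hp
    obtain ⟨A, rfl⟩ := mk_surjective p
    rw [substHom_mk, ← eval_mobius]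
    exact h _ (by rw [map_inv]; exact G.inv_mem hp)
  · intro h A hA
    have := h _ (G.inv_mem hA)
    rwa [← map_inv, substHom_mk, inv_inv, ← eval_mobius] at this

/-- The invariant rational functions form a subfield of codegree `|G|`, by Artin's theorem. -/
lemma exists_invariantField (G : Subgroup PGL(2, K)) [Finite G] :
    ∃ E : IntermediateField K (RatFunc K), (∀ R, IsInvariant G R ↔ R ∈ E) ∧
      Module.finrank E (RatFunc K) = Nat.card G := by
  let _ : MulSemiringAction G (RatFunc K) :=
    MulSemiringAction.compHom (RatFunc K) (substHom.comp G.subtype)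
  have smul_def : ∀ (p : G) (R : RatFunc K), p • R = substHom (p : PGL(2, K)) R := fun _ _ => rfl
  have : SMulCommClass G K (RatFunc K) := ⟨fun p a R => by
    obtain ⟨A, hA⟩ := mk_surjective (p : PGL(2, K))
    rw [smul_def, smul_def, ← hA, substHom_mk, substHom_mk, map_smul]⟩
  have : FaithfulSMul G (RatFunc K) := by
    refine ⟨fun {p q} h => ?_⟩
    have h1 : (p⁻¹ * q) • (RatFunc.X : RatFunc K) = RatFunc.X := by
      rw [mul_smul, ← h, inv_smul_smul]
    obtain ⟨A, hA⟩ := mk_surjective ((p⁻¹ * q : G) : PGL(2, K))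
    rw [smul_def, ← hA, substHom_mk, mobSubst_X] at h1
    have h2 := mk_eq_one_of_mobius_eq_X h1
    rw [map_inv, inv_eq_one, hA] at h2
    exact inv_mul_eq_one.1 (Subtype.ext h2)
  refine ⟨FixedPoints.intermediateField G, fun R => ?_, ?_⟩
  · rw [isInvariant_iff, FixedPoints.mem_intermediateField_iff]
    exact ⟨fun h p => h p p.2, fun h p hp => h ⟨p, hp⟩⟩
  · cases nonempty_fintype G
    rw [Nat.card_eq_fintype_card]
    exact FixedPoints.finrank_eq_card G (RatFunc K)

open IntermediateField in
theorem exists_isQuotientMap (G : Subgroup PGL(2, K)) [Finite G] :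
    ∃ g h : K[X], IsQuotientMap G g h := by
  obtain ⟨E, hE, hrank⟩ := exists_invariantField G
  set R := RatFunc.Luroth.generator E
  have hER : E = K⟮R⟯ := RatFunc.Luroth.eq_adjoin_generator
  have hmax : max R.num.natDegree R.denom.natDegree = Nat.card G := by
    rw [← RatFunc.finrank_eq_max_natDegree, ← hER, hrank]
  have hpos : 0 < Nat.card G := Nat.card_pos
  have hRdiv := R.num_div_denom
  have hdm := R.monic_denom
  by_cases hlt : R.denom.natDegree < R.num.natDegree
  · have hnum : R.num ≠ 0 := by
      rintro h0
      simp [h0] at hlt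
    have hlc : R.num.leadingCoeff⁻¹ ≠ 0 := inv_ne_zero (leadingCoeff_ne_zero.2 hnum)
    have hunit : IsUnit (C R.num.leadingCoeff⁻¹) := isUnit_C.2 hlc.isUnit
    have hnd : (R.num * C R.num.leadingCoeff⁻¹).natDegree = R.num.natDegree :=
      natDegree_mul_C hlc
    have hnd' : (R.denom * C R.num.leadingCoeff⁻¹).natDegree = R.denom.natDegree :=
      natDegree_mul_C hlc
    refine ⟨R.num * C R.num.leadingCoeff⁻¹, R.denom * C R.num.leadingCoeff⁻¹,
      ?_, monic_mul_leadingCoeff_inv hnum, ?_, mul_ne_zero R.denom_ne_zero hunit.ne_zero, ?_, ?_⟩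
    · exact (isCoprime_mul_unit_right hunit _ _).2 R.isCoprime_num_denom
    · rw [hnd, ← hmax, max_eq_left hlt.le]
    · rwa [hnd, hnd']
    · intro S
      rw [map_mul, map_mul, mul_div_mul_right _ _ (RatFunc.algebraMap_ne_zero hunit.ne_zero),
        hRdiv, hE, hER]
  · -- otherwise `R` is finite at infinity, with value `c`, and `1 / (R - c)` has a pole there
    rw [not_lt] at hlt
    rw [max_eq_right hlt] at hmax
    set c := R.num.coeff R.denom.natDegree
    set h := R.num - C c * R.denom
    have hcoeff : h.coeff R.denom.natDegree = 0 := by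
      simp [h, c, coeff_C_mul, hdm.coeff_natDegree]
    have hle : h.natDegree ≤ R.denom.natDegree :=
      (natDegree_sub_le _ _).trans (max_le hlt (natDegree_C_mul_le _ _))
    have hlt' : h.natDegree < R.denom.natDegree := by
      refine lt_of_le_of_ne hle fun heq => ?_
      have h0 : h = 0 := by rw [← leadingCoeff_eq_zero, leadingCoeff, heq, hcoeff]
      rw [h0, natDegree_zero] at heq
      omega
    have hd0 := RatFunc.algebraMap_ne_zero R.denom_ne_zero
    have hh : algebraMap K[X] (RatFunc K) h =
        (R - algebraMap K (RatFunc K) c) * algebraMap K[X] (RatFunc K) R.denom := by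
      rw [sub_mul, map_sub, map_mul, RatFunc.algebraMap_C, ← RatFunc.algebraMap_eq_C]
      congr 1
      rw [← div_eq_iff hd0, hRdiv]
    have hcop : IsCoprime R.denom h := by
      have := (R.isCoprime_num_denom.symm).add_mul_left_right (-C c)
      convert! this using 1
      simp only [h]; ring
    have hh0 : h ≠ 0 := by
      intro h0
      rw [h0, isCoprime_zero_right] at hcop
      have := natDegree_eq_zero_of_isUnit hcop
      omega
    have hQ : algebraMap K[X] (RatFunc K) R.denom / algebraMap K[X] (RatFunc K) h =
        (R - algebraMap K (RatFunc K) c)⁻¹ := by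
      rw [hh, div_mul_cancel_right₀ hd0]
    refine ⟨R.denom, h, hcop, hdm, hmax, hh0, hlt', fun S => ?_⟩
    rw [hQ, hE, hER]
    have e : K⟮R⟯ = K⟮(R - algebraMap K (RatFunc K) c)⁻¹⟯ := by
      apply le_antisymm <;> rw [adjoin_simple_le_iff]
      · have := mem_adjoin_simple_self K (R - algebraMap K (RatFunc K) c)⁻¹
        have := add_mem (inv_mem this) (IntermediateField.algebraMap_mem _ c)
        simpa using this
      · exact inv_mem (sub_mem (mem_adjoin_simple_self K R) (IntermediateField.algebraMap_mem _ c))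
    rw [e]

end Action

/-! ### The fibers of a quotient map -/

section Fiber
variable {G : Subgroup PGL(2, K)} {g h : K[X]}

lemma IsQuotientMap.aeval_mobius_div (hQ : IsQuotientMap G g h) {A : GL (Fin 2) K}
    (hA : Matrix.ProjGenLinGroup.mk A ∈ G) : aeval (mobius A) g / aeval (mobius A) h =
      algebraMap K[X] (RatFunc K) g / algebraMap K[X] (RatFunc K) h := by
  have := (hQ.generates _).2 (IntermediateField.mem_adjoin_simple_self K _) A hA
  rwa [eval_mobius, map_div₀, mobSubst_algebraMap, mobSubst_algebraMap] at this

lemma monic_sub_C_mul {L : Type*} [Field L] {g h : L[X]} (hg : g.Monic)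
    (hlt : h.natDegree < g.natDegree) (a : L) : (g - C a * h).Monic ∧
      (g - C a * h).natDegree = g.natDegree := by
  have h1 : (C a * h).natDegree < g.natDegree := (natDegree_C_mul_le _ _).trans_lt hlt
  refine ⟨hg.sub_of_left (degree_lt_degree h1), ?_⟩
  exact natDegree_sub_eq_left_of_natDegree_lt h1

/-- The `|G|` conjugates of `x` are the roots of `g - Q(x) h`. -/
lemma IsQuotientMap.generic_fiber (hQ : IsQuotientMap G g h) [Fintype G] :
    g.map (algebraMap K (RatFunc K)) - C (algebraMap K[X] (RatFunc K) g /
      algebraMap K[X] (RatFunc K) h) * h.map (algebraMap K (RatFunc K)) =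
    ∏ p : G, (X - C (mobius (rep (p : PGL(2, K))))) := by
  set M := g.map (algebraMap K (RatFunc K)) - C (algebraMap K[X] (RatFunc K) g /
      algebraMap K[X] (RatFunc K) h) * h.map (algebraMap K (RatFunc K))
  have hM := monic_sub_C_mul (hQ.monic.map (algebraMap K (RatFunc K)))
    (h := h.map (algebraMap K (RatFunc K))) (by
      rw [natDegree_map, natDegree_map]; exact hQ.natDegree_den) (algebraMap K[X] (RatFunc K) g /
      algebraMap K[X] (RatFunc K) h)
  have hmonic : (∏ p : G, (X - C (mobius (rep (p : PGL(2, K)))))).Monic :=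
    monic_prod_of_monic _ _ fun p _ => monic_X_sub_C _
  refine (eq_of_monic_of_dvd_of_natDegree_le hmonic hM.1 ?_ ?_)
  · refine Finset.prod_dvd_of_coprime (fun p _ q _ hpq => ?_) fun p _ => ?_
    · refine isCoprime_X_sub_C_of_isUnit_sub (IsUnit.mk0 _ (sub_ne_zero.2 fun heq => hpq ?_))
      set x : regPts G (RatFunc K) := ⟨RatFunc.X, X_mem_regPts G⟩
      have h1 : p • x = q • x := Subtype.ext (by
        rw [coe_smul, coe_smul, ← mobius_eq_mobPt, ← mobius_eq_mobPt, heq])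
      have h2 : (p⁻¹ * q) • x = x := by rw [mul_smul, ← h1, inv_smul_smul]
      have h3 := congrArg Subtype.val h2
      rw [coe_smul, ← mobius_eq_mobPt] at h3
      have h4 := mk_eq_one_of_mobius_eq_X h3
      rw [mk_rep] at h4
      exact inv_mul_eq_one.1 (Subtype.ext h4)
    · rw [dvd_iff_isRoot, IsRoot, eval_sub, eval_mul, eval_C, eval_map_algebraMap,
        eval_map_algebraMap, sub_eq_zero]
      have hne : aeval (mobius (rep (p : PGL(2, K)))) h ≠ 0 := fun h0 => hQ.den_ne_zero
        ((transcendental_iff.1 (transcendental_mobius _)) h h0)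
      rw [← div_eq_iff hne]
      exact hQ.aeval_mobius_div (by rw [mk_rep]; exact p.2)
  · rw [hM.2, natDegree_map, hQ.natDegree_num, natDegree_prod_of_monic _ _
      fun p _ => monic_X_sub_C _]
    simp

/-- The generic fiber with denominators cleared, an identity in `K[x][T]` that can be specialized at
every point. -/
lemma IsQuotientMap.bivariate_fiber (hQ : IsQuotientMap G g h) [Fintype G] :
    (g.map C * C h - C g * h.map C) * ∏ p : G, C (mobDen (rep (p : PGL(2, K)))) =
      C h * ∏ p : G, (C (mobDen (rep (p : PGL(2, K)))) * X - C (mobNum (rep (p : PGL(2, K))))) := by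
  apply Polynomial.map_injective (algebraMap K[X] (RatFunc K)) (RatFunc.algebraMap_injective K)
  have hh := RatFunc.algebraMap_ne_zero hQ.den_ne_zero
  have hC : (algebraMap K[X] (RatFunc K)).comp C = algebraMap K (RatFunc K) := by
    rw [RatFunc.algebraMap_comp_C, RatFunc.algebraMap_eq_C]
  simp only [Polynomial.map_mul, Polynomial.map_sub, Polynomial.map_prod, map_C, map_X,
    Polynomial.map_map, hC]
  have h1 : ∀ p : G, C (algebraMap K[X] (RatFunc K) (mobDen (rep (p : PGL(2, K))))) * X -
      C (algebraMap K[X] (RatFunc K) (mobNum (rep (p : PGL(2, K))))) =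
      (X - C (mobius (rep (p : PGL(2, K))))) *
        C (algebraMap K[X] (RatFunc K) (mobDen (rep (p : PGL(2, K))))) := by
    intro p
    rw [sub_mul, mobius, ← C_mul, div_mul_cancel₀ _ (RatFunc.algebraMap_ne_zero (mobDen_ne_zero _)),
      mul_comm]
  rw [Finset.prod_congr rfl fun p _ => h1 p, Finset.prod_mul_distrib, ← hQ.generic_fiber,
    ← mul_assoc]
  congr 1
  rw [mul_sub, ← mul_assoc (C _) (C _) (Polynomial.map _ h), ← C_mul, mul_div_cancel₀ _ hh]
  ring

variable {L : Type*} [Field L] [Algebra K L]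

lemma IsQuotientMap.aeval_fiber (hQ : IsQuotientMap G g h) [Fintype G] (γ : L) :
    (g.map (algebraMap K L) * C (aeval γ h) - C (aeval γ g) * h.map (algebraMap K L)) *
      ∏ p : G, C (aeval γ (mobDen (rep (p : PGL(2, K))))) =
    C (aeval γ h) * ∏ p : G, (C (aeval γ (mobDen (rep (p : PGL(2, K))))) * X -
      C (aeval γ (mobNum (rep (p : PGL(2, K)))))) := by
  have := congrArg (Polynomial.map (aeval γ : K[X] →ₐ[K] L).toRingHom) hQ.bivariate_fiber
  have hC : ((aeval γ : K[X] →ₐ[K] L) : K[X] →+* L).comp C = algebraMap K L := by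
    ext; simp
  simpa only [Polynomial.map_mul, Polynomial.map_sub, Polynomial.map_prod, map_C, map_X,
    Polynomial.map_map, hC, AlgHom.toRingHom_eq_coe, RingHom.coe_coe] using this

/-- The numerator does not vanish at a pole. -/
lemma IsQuotientMap.aeval_num_or (hQ : IsQuotientMap G g h) {γ : L} (h0 : aeval γ h = 0) :
    aeval γ g ≠ 0 := by
  obtain ⟨u, v, huv⟩ := hQ.coprime
  intro h1
  simpa [h0, h1] using congrArg (aeval γ) huv

/-- The poles of a quotient map form the orbit of infinity. -/
lemma IsQuotientMap.mem_regPts_iff (hQ : IsQuotientMap G g h) [Finite G] (γ : L) :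
    γ ∈ regPts G L ↔ aeval γ h ≠ 0 := by
  cases nonempty_fintype G
  have key := hQ.aeval_fiber γ
  constructor
  · intro hγ h0
    rw [h0, C_0, mul_zero, zero_sub, zero_mul, mul_eq_zero, Finset.prod_eq_zero_iff, neg_eq_zero,
      mul_eq_zero, C_eq_zero, Polynomial.map_eq_zero] at key
    rcases key with (h1 | h1) | ⟨p, -, h1⟩
    · exact hQ.aeval_num_or h0 h1
    · exact hQ.den_ne_zero h1
    · exact hγ _ (by rw [mk_rep]; exact p.2) (C_eq_zero.1 h1)
  · intro hh A hA h0
    have h1 : aeval γ (mobDen (rep (Matrix.ProjGenLinGroup.mk A))) = 0 := by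
      obtain ⟨u, hu⟩ := mk_eq_mk_iff.1 (mk_rep (Matrix.ProjGenLinGroup.mk A)).symm
      rw [← hu, mobDen_mul_scalar, map_mul, h0, mul_zero]
    rw [Finset.prod_eq_zero (Finset.mem_univ (⟨Matrix.ProjGenLinGroup.mk A, hA⟩ : G)) (by rw [h1, C_0]), mul_zero,
      eq_comm, mul_eq_zero, C_eq_zero, Finset.prod_eq_zero_iff] at key
    rcases key with h2 | ⟨p, -, h2⟩
    · exact hh h2
    · have e1 := congrArg (coeff · 1) h2
      have e0 := congrArg (coeff · 0) h2
      simp only [coeff_sub, coeff_mul_X, coeff_C_zero, coeff_C_succ, coeff_zero, sub_zero,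
        mul_coeff_zero, coeff_X_zero, mul_zero, zero_sub, neg_eq_zero] at e1 e0
      exact aeval_mobNum_ne_zero _ e1 e0

/-- The value of `g / h` at `γ`; it is the junk value `0` at the poles, which `regPts` excludes. -/
def quotVal (g h : K[X]) (γ : L) : L := aeval γ g / aeval γ h

/-- Multiplicities included, the fiber of a quotient map through `γ` is the orbit of `γ`. -/
lemma IsQuotientMap.fiber (hQ : IsQuotientMap G g h) [Fintype G] (γ : regPts G L) :
    g.map (algebraMap K L) - C (quotVal g h (γ : L)) * h.map (algebraMap K L) =
      ∏ p : G, (X - C ((p • γ : regPts G L) : L)) := by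
  have hh := (hQ.mem_regPts_iff (γ : L)).1 γ.2
  have key := hQ.aeval_fiber (γ : L)
  have hd : ∀ p : G, aeval (γ : L) (mobDen (rep (p : PGL(2, K)))) ≠ 0 := fun p =>
    γ.2 _ (by rw [mk_rep]; exact p.2)
  have hprod : ∏ p : G, C (aeval (γ : L) (mobDen (rep (p : PGL(2, K))))) ≠ 0 :=
    Finset.prod_ne_zero_iff.2 fun p _ => C_ne_zero.2 (hd p)
  apply mul_left_cancel₀ (C_ne_zero.2 hh)
  apply mul_right_cancel₀ hprod
  rw [mul_assoc _ (∏ p : G, _), ← Finset.prod_mul_distrib]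
  have h1 : ∀ p : G, (X - C ((p • γ : regPts G L) : L)) *
      C (aeval (γ : L) (mobDen (rep (p : PGL(2, K))))) =
      C (aeval (γ : L) (mobDen (rep (p : PGL(2, K))))) * X -
      C (aeval (γ : L) (mobNum (rep (p : PGL(2, K))))) := by
    intro p
    rw [sub_mul, ← C_mul, coe_smul, mobPt, div_mul_cancel₀ _ (hd p), mul_comm]
  rw [Finset.prod_congr rfl fun p _ => h1 p, ← key, mul_sub, ← mul_assoc, ← C_mul, quotVal,
    mul_div_cancel₀ _ hh, mul_comm (C _) (Polynomial.map _ g)]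

end Fiber

section Conjugation
variable {L : Type*} [Field L] [Algebra K L] {G : Subgroup PGL(2, K)} {g h : K[X]}

/-! ### Points, orbits and conjugation over the base field -/

section Galois

lemma aeval_algEquiv (σ : L ≃ₐ[K] L) (γ : L) (p : K[X]) : aeval (σ γ) p = σ (aeval γ p) :=
  aeval_algHom_apply σ.toAlgHom γ p

lemma mobPt_algEquiv (σ : L ≃ₐ[K] L) (A : GL (Fin 2) K) (γ : L) :
    mobPt A (σ γ) = σ (mobPt A γ) := by
  rw [mobPt, mobPt, aeval_algEquiv, aeval_algEquiv, map_div₀]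

lemma quotVal_algEquiv (σ : L ≃ₐ[K] L) (γ : L) : quotVal g h (σ γ) = σ (quotVal g h γ) := by
  rw [quotVal, quotVal, aeval_algEquiv, aeval_algEquiv, map_div₀]

/-- The action of a `K`-automorphism of `L` on the points outside the orbit of infinity. -/
def galMap (σ : L ≃ₐ[K] L) (γ : regPts G L) : regPts G L :=
  ⟨σ γ, fun A hA => by
    rw [aeval_algEquiv]
    exact (map_ne_zero σ).2 (γ.2 A hA)⟩

@[simp] lemma coe_galMap (σ : L ≃ₐ[K] L) (γ : regPts G L) : (galMap σ γ : L) = σ γ := rfl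

lemma smul_galMap (σ : L ≃ₐ[K] L) (p : G) (γ : regPts G L) :
    p • galMap σ γ = galMap σ (p • γ) :=
  Subtype.ext (mobPt_algEquiv σ _ _)

lemma galMap_injective (σ : L ≃ₐ[K] L) : Function.Injective (galMap (G := G) σ) :=
  fun _ _ h => Subtype.ext (σ.injective (congrArg Subtype.val h))

lemma stabilizer_galMap (σ : L ≃ₐ[K] L) (γ : regPts G L) :
    MulAction.stabilizer G (galMap σ γ) = MulAction.stabilizer G γ := by
  ext p
  rw [MulAction.mem_stabilizer_iff, MulAction.mem_stabilizer_iff, smul_galMap,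
    (galMap_injective σ).eq_iff]

lemma card_stabilizer_smul (p : G) (γ : regPts G L) :
    Nat.card (MulAction.stabilizer G (p • γ)) = Nat.card (MulAction.stabilizer G γ) :=
  (Nat.card_congr (MulAction.stabilizerEquivStabilizer (g := p) rfl).toEquiv).symm

lemma minpoly_algEquiv (σ : L ≃ₐ[K] L) (γ : L) : minpoly K (σ γ) = minpoly K γ :=
  minpoly.algEquiv_eq σ γ

variable [Normal K L]

lemma exists_algEquiv_of_minpoly_eq {γ δ : L} (hm : minpoly K γ = minpoly K δ) :
    ∃ σ : L ≃ₐ[K] L, σ γ = δ := by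
  obtain ⟨σ, hσ⟩ := isConjRoot_iff_exists_algEquiv.1 (show IsConjRoot K δ γ from hm.symm)
  exact ⟨σ, hσ⟩

lemma minpoly_smul_eq {γ δ : regPts G L} (hm : minpoly K (γ : L) = minpoly K (δ : L)) (p : G) :
    minpoly K ((p • γ : regPts G L) : L) = minpoly K ((p • δ : regPts G L) : L) := by
  obtain ⟨σ, hσ⟩ := exists_algEquiv_of_minpoly_eq hm
  have : δ = galMap σ γ := Subtype.ext hσ.symm
  rw [this, smul_galMap, coe_galMap, minpoly_algEquiv]

end Galois

section FiberRoots

/-- Two points have the same value under a quotient map if and only if they are in one orbit. -/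
lemma IsQuotientMap.quotVal_eq_iff (hQ : IsQuotientMap G g h) [Finite G] (γ δ : regPts G L) :
    quotVal g h (δ : L) = quotVal g h (γ : L) ↔ ∃ p : G, δ = p • γ := by
  cases nonempty_fintype G
  have hh := (hQ.mem_regPts_iff (δ : L)).1 δ.2
  have key := congrArg (eval (δ : L)) (hQ.fiber γ)
  rw [eval_sub, eval_mul, eval_C, eval_map_algebraMap, eval_map_algebraMap, eval_prod] at key
  rw [quotVal, div_eq_iff hh, ← sub_eq_zero, key, Finset.prod_eq_zero_iff]
  simp [sub_eq_zero, Subtype.ext_iff]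

lemma IsQuotientMap.monic_sub (hQ : IsQuotientMap G g h) (a : L) :
    (g.map (algebraMap K L) - C a * h.map (algebraMap K L)).Monic :=
  (monic_sub_C_mul (hQ.monic.map _) (by
    rw [natDegree_map, natDegree_map]; exact hQ.natDegree_den) a).1

/-- The multiplicity of a point in its fiber is the order of its stabilizer. -/
lemma IsQuotientMap.count_roots_fiber (hQ : IsQuotientMap G g h) [Finite G] [DecidableEq L]
    (γ : regPts G L) :
    ((g.map (algebraMap K L) - C (quotVal g h (γ : L)) * h.map (algebraMap K L)).roots).count
      (γ : L) = Nat.card (MulAction.stabilizer G γ) := by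
  classical
  cases nonempty_fintype G
  rw [hQ.fiber γ]
  have : (∏ p : G, (X - C ((p • γ : regPts G L) : L))).roots =
      Multiset.map (fun p : G => ((p • γ : regPts G L) : L)) Finset.univ.val := by
    rw [← roots_multiset_prod_X_sub_C (Multiset.map (fun p : G => ((p • γ : regPts G L) : L))
      Finset.univ.val), Multiset.map_map]
    rfl
  rw [this, Multiset.count_map, ← Finset.filter_val, Finset.card_val, Nat.card_eq_fintype_card,
    Fintype.card_subtype]
  congr 1
  ext p
  simp only [Finset.mem_filter, Finset.mem_univ, true_and, MulAction.mem_stabilizer_iff]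
  rw [Subtype.ext_iff, eq_comm]

/-- A root of `g - a h` is not a pole, and the quotient map takes the value `a` there. -/
lemma IsQuotientMap.quotVal_eq_of_isRoot (hQ : IsQuotientMap G g h) [Finite G] {a δ : L}
    (hr : (g.map (algebraMap K L) - C a * h.map (algebraMap K L)).IsRoot δ) :
    δ ∈ regPts G L ∧ quotVal g h δ = a := by
  rw [IsRoot, eval_sub, eval_mul, eval_C, eval_map_algebraMap, eval_map_algebraMap,
    sub_eq_zero] at hr
  have hh : aeval δ h ≠ 0 := fun h0 => hQ.aeval_num_or h0 (by rw [hr, h0, mul_zero])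
  exact ⟨(hQ.mem_regPts_iff δ).2 hh, by rw [quotVal, div_eq_iff hh, hr]⟩

end FiberRoots

/-! ### Transforms as powers of orbit products -/

section Core
lemma count_roots_prod {ι : Type*} [DecidableEq L] (s : Finset ι) (f : ι → L[X])
    (hf : ∀ i ∈ s, f i ≠ 0) (a : L) :
    (∏ i ∈ s, f i).roots.count a = ∑ i ∈ s, (f i).roots.count a := by
  rw [roots_prod _ _ (Finset.prod_ne_zero_iff.2 hf), Multiset.count_bind]
  rfl

variable [Normal K L]

/-- The minimal polynomials of `γ` and `δ` are in one `G`-orbit if and only if the values of the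
quotient map at `γ` and `δ` are conjugate over `K`. -/
lemma IsQuotientMap.minpoly_mem_orbit_iff (hQ : IsQuotientMap G g h) [Finite G]
    (γ δ : regPts G L) : minpoly K (δ : L) ∈ orbit G (minpoly K (γ : L)) ↔
      minpoly K (quotVal g h (δ : L)) = minpoly K (quotVal g h (γ : L)) := by
  rw [orbit_minpoly]
  constructor
  · rintro ⟨p, hp⟩
    obtain ⟨σ, hσ⟩ := exists_algEquiv_of_minpoly_eq hp
    rw [← hσ, quotVal_algEquiv, minpoly_algEquiv, (hQ.quotVal_eq_iff γ (p • γ)).2 ⟨p, rfl⟩]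
  · intro hm
    obtain ⟨σ, hσ⟩ := exists_algEquiv_of_minpoly_eq hm.symm
    rw [← quotVal_algEquiv, ← coe_galMap, eq_comm, hQ.quotVal_eq_iff] at hσ
    obtain ⟨p, hp⟩ := hσ
    refine ⟨p, ?_⟩
    rw [hp, smul_galMap, coe_galMap, minpoly_algEquiv]

lemma card_stabilizer_of_mem_orbit {γ δ : regPts G L}
    (hm : minpoly K (δ : L) ∈ orbit G (minpoly K (γ : L))) :
    Nat.card (MulAction.stabilizer G δ) = Nat.card (MulAction.stabilizer G γ) := by
  rw [orbit_minpoly] at hm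
  obtain ⟨p, hp⟩ := hm
  obtain ⟨σ, hσ⟩ := exists_algEquiv_of_minpoly_eq hp
  have : δ = galMap σ (p • γ) := Subtype.ext hσ.symm
  rw [this, stabilizer_galMap, card_stabilizer_smul]

lemma mem_regPts_of_minpoly_mem_orbit (γ : regPts G L) {δ : L}
    (hm : minpoly K δ ∈ orbit G (minpoly K (γ : L))) : δ ∈ regPts G L := by
  rw [orbit_minpoly] at hm
  obtain ⟨p, hp⟩ := hm
  obtain ⟨σ, hσ⟩ := exists_algEquiv_of_minpoly_eq hp
  rw [← hσ]
  exact (galMap σ (p • γ)).2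

lemma finite_orbit_minpoly [Finite G] (γ : regPts G L) : (orbit G (minpoly K (γ : L))).Finite := by
  rw [orbit_minpoly]
  exact Set.finite_range _

lemma monic_of_mem_orbit (γ : regPts G L) {t : K[X]} (ht : t ∈ orbit G (minpoly K (γ : L))) :
    t.Monic := by
  rw [orbit_minpoly] at ht
  obtain ⟨p, rfl⟩ := ht
  exact minpoly.monic (Algebra.IsIntegral.isIntegral _)

variable [IsAlgClosed L] [Algebra.IsSeparable K L]

lemma map_minpoly_eq_prod [DecidableEq L] (β : L) : (minpoly K β).map (algebraMap K L) =
    (((minpoly K β).aroots L).toFinset.val.map fun a => X - C a).prod := by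
  have hm : ((minpoly K β).map (algebraMap K L)).Monic :=
    (minpoly.monic (Algebra.IsIntegral.isIntegral β)).map _
  have hs : ((minpoly K β).aroots L).Nodup :=
    nodup_aroots_iff_of_splits (minpoly.ne_zero (Algebra.IsIntegral.isIntegral β))
      (IsAlgClosed.splits _) |>.2 (Algebra.IsSeparable.isSeparable K β)
  rw [Multiset.toFinset_val, Multiset.dedup_eq_self.2 hs]
  exact (IsAlgClosed.splits _).eq_prod_roots_of_monic hm

lemma count_roots_minpoly [DecidableEq L] (γ δ : L) [Decidable (minpoly K γ = minpoly K δ)] :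
    ((minpoly K γ).map (algebraMap K L)).roots.count δ =
      if minpoly K γ = minpoly K δ then 1 else 0 := by
  have hne := minpoly.ne_zero (Algebra.IsIntegral.isIntegral (R := K) γ)
  have hs : ((minpoly K γ).aroots L).Nodup :=
    nodup_aroots_iff_of_splits hne (IsAlgClosed.splits _) |>.2 (Algebra.IsSeparable.isSeparable K γ)
  change ((minpoly K γ).aroots L).count δ = _
  split_ifs with he
  · refine Multiset.count_eq_one_of_mem hs ((mem_aroots.2 ⟨hne, ?_⟩))
    rw [he, minpoly.aeval]
  · refine Multiset.count_eq_zero_of_notMem fun hmem => he ?_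
    exact minpoly.eq_of_irreducible_of_monic (minpoly.irreducible (Algebra.IsIntegral.isIntegral γ))
      (mem_aroots.1 hmem).2 (minpoly.monic (Algebra.IsIntegral.isIntegral γ))

/-- The transform of the minimal polynomial of `Q(γ)` is the product of the orbit of the minimal
polynomial of `γ`, raised to the order of the stabilizer of `γ`. -/
theorem IsQuotientMap.ratTransform_minpoly (hQ : IsQuotientMap G g h) [Finite G]
    (γ : regPts G L) : ratTransform (minpoly K (quotVal g h (γ : L))) g h =
      (∏ᶠ t ∈ orbit G (minpoly K (γ : L)), t) ^ Nat.card (MulAction.stabilizer G γ) := by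
  classical
  have hfin := finite_orbit_minpoly γ
  rw [finprod_mem_eq_finite_toFinset_prod _ hfin]
  set O := hfin.toFinset
  have hO : ∀ t, t ∈ O ↔ t ∈ orbit G (minpoly K (γ : L)) := fun t => hfin.mem_toFinset
  apply Polynomial.map_injective (algebraMap K L) (algebraMap K L).injective
  have hhL : h.map (algebraMap K L) ≠ 0 := by
    simpa [Polynomial.map_eq_zero] using hQ.den_ne_zero
  rw [ratTransform_map, map_minpoly_eq_prod, ratTransform_multiset_prod _ _ _ hhL,
    Polynomial.map_pow, Polynomial.map_prod]
  set S := ((minpoly K (quotVal g h (γ : L))).aroots L).toFinset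
  have hS : ∀ a, a ∈ S ↔ minpoly K a = minpoly K (quotVal g h (γ : L)) := by
    intro a
    rw [Multiset.mem_toFinset, mem_aroots]
    constructor
    · rintro ⟨-, ha⟩
      exact (minpoly.eq_of_irreducible_of_monic
        (minpoly.irreducible (Algebra.IsIntegral.isIntegral _)) ha
        (minpoly.monic (Algebra.IsIntegral.isIntegral _))).symm
    · intro ha
      exact ⟨minpoly.ne_zero (Algebra.IsIntegral.isIntegral _), by rw [← ha, minpoly.aeval]⟩
  change ∏ a ∈ S, (g.map (algebraMap K L) - C a * h.map (algebraMap K L)) = _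
  have hmon : ∀ t ∈ O, (t.map (algebraMap K L)).Monic := fun t ht =>
    (monic_of_mem_orbit γ ((hO t).1 ht)).map _
  rw [(IsAlgClosed.splits (∏ a ∈ S, _)).eq_prod_roots_of_monic
      (monic_prod_of_monic _ _ fun a _ => hQ.monic_sub a),
    (IsAlgClosed.splits ((∏ t ∈ O, _) ^ _)).eq_prod_roots_of_monic
      ((monic_prod_of_monic _ _ hmon).pow _)]
  -- both sides are determined by the multiplicities of their roots
  congr 2
  ext δ
  rw [count_roots_prod _ _ fun a _ => (hQ.monic_sub a).ne_zero, roots_pow, Multiset.count_nsmul,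
    count_roots_prod _ _ fun t ht => (hmon t ht).ne_zero]
  -- on the right, only the minimal polynomial of `δ` can vanish at `δ`, and it does so simply
  have hR : ∑ t ∈ O, (t.map (algebraMap K L)).roots.count δ =
      if minpoly K δ ∈ orbit G (minpoly K (γ : L)) then 1 else 0 := by
    rw [← if_congr (hO _) rfl rfl, ← Finset.sum_ite_eq' O (minpoly K δ) fun _ => 1]
    refine Finset.sum_congr rfl fun t ht => ?_
    rw [hO, orbit_minpoly] at ht
    obtain ⟨p, rfl⟩ := ht
    exact count_roots_minpoly _ _
  rw [hR]
  by_cases hδ : δ ∈ regPts G L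
  · -- on the left, only the fiber over the value at `δ` contains `δ`
    have hL : ∑ a ∈ S, (g.map (algebraMap K L) - C a * h.map (algebraMap K L)).roots.count δ =
        if quotVal g h δ ∈ S then Nat.card (MulAction.stabilizer G (⟨δ, hδ⟩ : regPts G L))
          else 0 := by
      rw [← Finset.sum_ite_eq S (quotVal g h δ) fun _ => _]
      refine Finset.sum_congr rfl fun a _ => ?_
      split_ifs with ha
      · rw [← ha]
        exact hQ.count_roots_fiber ⟨δ, hδ⟩
      · refine Multiset.count_eq_zero_of_notMem fun hmem => ha ?_
        exact (hQ.quotVal_eq_of_isRoot (isRoot_of_mem_roots hmem)).2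
    rw [hL]
    by_cases hm : minpoly K δ ∈ orbit G (minpoly K (γ : L))
    · rw [if_pos hm, if_pos ((hS _).2 ((hQ.minpoly_mem_orbit_iff γ ⟨δ, hδ⟩).1 hm)), mul_one]
      exact card_stabilizer_of_mem_orbit (δ := ⟨δ, hδ⟩) hm
    · rw [if_neg hm, if_neg fun h' => hm ((hQ.minpoly_mem_orbit_iff γ ⟨δ, hδ⟩).2 ((hS _).1 h')),
        mul_zero]
  · rw [if_neg fun hm => hδ (mem_regPts_of_minpoly_mem_orbit γ hm), mul_zero]
    refine Finset.sum_eq_zero fun a _ => Multiset.count_eq_zero_of_notMem fun hmem => hδ ?_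
    exact (hQ.quotVal_eq_of_isRoot (isRoot_of_mem_roots hmem)).1

end Core

end Conjugation

/-! ### The points outside the orbit of infinity and their minimal polynomials -/

section Pole

lemma inv_entries (A : GL (Fin 2) K) :
    A⁻¹ 0 0 = (A 0 0 * A 1 1 - A 0 1 * A 1 0)⁻¹ * A 1 1 ∧
    A⁻¹ 1 0 = -((A 0 0 * A 1 1 - A 0 1 * A 1 0)⁻¹ * A 1 0) ∧
    A⁻¹ 1 1 = (A 0 0 * A 1 1 - A 0 1 * A 1 0)⁻¹ * A 0 0 := by
  have h : ((A⁻¹ : GL (Fin 2) K) : Matrix (Fin 2) (Fin 2) K) = (A : Matrix (Fin 2) (Fin 2) K)⁻¹ :=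
    Matrix.coe_units_inv A
  rw [h, Matrix.inv_def, Matrix.det_fin_two, Matrix.adjugate_fin_two, Ring.inverse_eq_inv']
  simp

lemma mobDen_one_zero_ne_zero {L : Type*} [Field L] [Algebra K L] {A : GL (Fin 2) K} {γ : L}
    (h : aeval γ (mobDen A) = 0) : A 1 0 ≠ 0 := by
  intro h0
  rw [aeval_mobDen, h0, map_zero, zero_mul, zero_add, map_eq_zero] at h
  exact det_ne_zero A (by simp [h0, h])

lemma eq_X_sub_C_of_eval_eq_zero {f : K[X]} (hm : f.Monic) (hi : Irreducible f) {a : K}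
    (ha : f.eval a = 0) : f = X - C a :=
  (eq_of_monic_of_associated (monic_X_sub_C a) hm
    ((irreducible_X_sub_C a).associated_of_dvd hi (dvd_iff_isRoot.2 ha))).symm

variable {G : Subgroup PGL(2, K)} {L : Type*} [Field L] [Algebra K L]

/-- The members of `irrNR G` are the minimal polynomials of the points outside the orbit of infinity;
see `exists_regPts_of_mem_irrNR` for the converse. -/
lemma minpoly_mem_irrNR [Algebra.IsAlgebraic K L] (γ : regPts G L) :
    minpoly K (γ : L) ∈ irrNR G := by
  have hint : IsIntegral K (γ : L) := Algebra.IsIntegral.isIntegral _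
  refine ⟨minpoly.monic hint, minpoly.irreducible hint, fun A hA hc h0 => ?_⟩
  have h1 := eq_X_sub_C_of_eval_eq_zero (minpoly.monic hint) (minpoly.irreducible hint) h0
  have h2 : (γ : L) = algebraMap K L (A 0 0 / A 1 0) := by
    have := minpoly.aeval K (γ : L)
    rw [h1] at this
    simpa [sub_eq_zero] using this
  have hA' : Matrix.ProjGenLinGroup.mk A⁻¹ ∈ G := by rw [map_inv]; exact G.inv_mem hA
  apply γ.2 A⁻¹ hA'
  rw [aeval_mobDen, h2, ← map_mul, ← map_add, (inv_entries A).2.1, (inv_entries A).2.2]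
  convert! map_zero (algebraMap K L)
  field_simp
  ring

lemma exists_regPts_of_mem_irrNR [IsAlgClosed L] {r : K[X]} (hr : r ∈ irrNR G) :
    ∃ γ : regPts G L, r = minpoly K (γ : L) := by
  obtain ⟨hm, hi, hn⟩ := hr
  obtain ⟨γ, hγ⟩ := IsAlgClosed.exists_aeval_eq_zero L r (degree_pos_of_irreducible hi).ne'
  refine ⟨⟨γ, fun A hA h0 => ?_⟩, minpoly.eq_of_irreducible_of_monic hi hγ hm⟩
  have hc := mobDen_one_zero_ne_zero h0
  have hd := inv_ne_zero (det_ne_zero A)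
  have hA' : Matrix.ProjGenLinGroup.mk A⁻¹ ∈ G := by rw [map_inv]; exact G.inv_mem hA
  have hc' : algebraMap K L (A 1 0) ≠ 0 := by simpa using hc
  apply hn A⁻¹ hA'
  · rw [(inv_entries A).2.1]
    exact neg_ne_zero.2 (mul_ne_zero hd hc)
  · rw [(inv_entries A).1, (inv_entries A).2.1, div_neg, mul_div_mul_left _ _ hd]
    apply (algebraMap K L).injective
    rw [← aeval_algebraMap_apply_eq_algebraMap_eval, map_zero, ← hγ]
    congr 2
    rw [aeval_mobDen] at h0
    rw [map_neg, map_div₀, neg_eq_iff_eq_neg, div_eq_iff hc']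
    linear_combination h0

end Pole

/-! ### Orbits of polynomials -/

section Orbit
variable {G : Subgroup PGL(2, K)} {L : Type*} [Field L] [Algebra K L] [Normal K L]

lemma minpoly_mem_orbit_self (γ : regPts G L) :
    minpoly K (γ : L) ∈ orbit G (minpoly K (γ : L)) := by
  rw [orbit_minpoly]
  exact ⟨1, by simp⟩

lemma orbit_eq_of_mem {γ δ : regPts G L}
    (hm : minpoly K (γ : L) ∈ orbit G (minpoly K (δ : L))) :
    orbit G (minpoly K (γ : L)) = orbit G (minpoly K (δ : L)) := by
  rw [orbit_minpoly] at hm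
  obtain ⟨p, hp⟩ := hm
  ext t
  rw [orbit_minpoly, orbit_minpoly]
  constructor
  · rintro ⟨q, rfl⟩
    refine ⟨q * p, ?_⟩
    change minpoly K (((q * p) • δ : regPts G L) : L) = _
    rw [mul_smul]
    exact minpoly_smul_eq hp q
  · rintro ⟨q, rfl⟩
    refine ⟨q * p⁻¹, ?_⟩
    have := minpoly_smul_eq hp (q * p⁻¹)
    rw [smul_smul, inv_mul_cancel_right] at this
    exact this.symm

/-- The size of an orbit divides `|G|`: it is the index of the subgroup of those `p` for which
`p • γ` is conjugate to `γ` over `K`. -/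
lemma ncard_orbit_minpoly_dvd (γ : regPts G L) :
    (orbit G (minpoly K (γ : L))).ncard ∣ Nat.card G := by
  set f : G → K[X] := fun p => minpoly K ((p • γ : regPts G L) : L)
  let H : Subgroup G :=
    { carrier := {p | f p = f 1}
      one_mem' := rfl
      mul_mem' := fun {p q} hp hq => by
        have hp' : f p = f 1 := hp
        have := minpoly_smul_eq (show minpoly K ((q • γ : regPts G L) : L) =
          minpoly K (((1 : G) • γ : regPts G L) : L) from hq) p
        rw [smul_smul, smul_smul, mul_one] at this
        exact this.trans hp'
      inv_mem' := fun {p} hp => by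
        have := minpoly_smul_eq (show minpoly K ((p • γ : regPts G L) : L) =
          minpoly K (((1 : G) • γ : regPts G L) : L) from hp) p⁻¹
        rw [smul_smul, smul_smul, inv_mul_cancel, mul_one] at this
        exact this.symm }
  have hker : QuotientGroup.leftRel H = Setoid.ker f := by
    ext p q
    rw [QuotientGroup.leftRel_apply, Setoid.ker_def]
    constructor
    · intro hpq
      have := minpoly_smul_eq (show minpoly K (((p⁻¹ * q) • γ : regPts G L) : L) =
          minpoly K (((1 : G) • γ : regPts G L) : L) from hpq) p
      rw [smul_smul, smul_smul, mul_inv_cancel_left, mul_one] at this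
      exact this.symm
    · intro hpq
      have := minpoly_smul_eq (show minpoly K ((p • γ : regPts G L) : L) =
          minpoly K ((q • γ : regPts G L) : L) from hpq) p⁻¹
      rw [smul_smul, smul_smul, inv_mul_cancel] at this
      exact this.symm
  have hcard : (orbit G (minpoly K (γ : L))).ncard = H.index := by
    rw [orbit_minpoly, Set.ncard, Set.encard, ENat.card, Subgroup.index]
    change Nat.card _ = _
    rw [Nat.card_congr (Setoid.quotientKerEquivRange f).symm, ← hker]
    rfl
  rw [hcard]
  exact H.index_dvd_card

lemma natDegree_of_mem_orbit (γ : regPts G L) {t : K[X]} (ht : t ∈ orbit G (minpoly K (γ : L))) :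
    t.natDegree = (minpoly K (γ : L)).natDegree := by
  rw [orbit_minpoly] at ht
  obtain ⟨p, rfl⟩ := ht
  exact natDegree_minpoly_smul p γ

variable [Finite G]

lemma natDegree_prod_orbit (γ : regPts G L) :
    (∏ᶠ t ∈ orbit G (minpoly K (γ : L)), t).natDegree =
      (orbit G (minpoly K (γ : L))).ncard * (minpoly K (γ : L)).natDegree := by
  have hfin := finite_orbit_minpoly γ
  rw [finprod_mem_eq_finite_toFinset_prod _ hfin, natDegree_prod_of_monic _ _ fun t ht =>
    monic_of_mem_orbit γ (hfin.mem_toFinset.1 ht), Set.ncard_eq_toFinset_card _ hfin]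
  exact Finset.sum_const_nat fun t ht => natDegree_of_mem_orbit γ (hfin.mem_toFinset.1 ht)

lemma mem_orbit_of_dvd (γ : regPts G L) {t : K[X]} (htm : t.Monic) (hti : Irreducible t) {k : ℕ}
    (hdvd : t ∣ (∏ᶠ t ∈ orbit G (minpoly K (γ : L)), t) ^ k) :
    t ∈ orbit G (minpoly K (γ : L)) := by
  have hfin := finite_orbit_minpoly γ
  rw [finprod_mem_eq_finite_toFinset_prod _ hfin] at hdvd
  obtain ⟨u, hu, htu⟩ := (hti.prime.dvd_finsetProd_iff _).1 (hti.prime.dvd_of_dvd_pow hdvd)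
  rw [hfin.mem_toFinset] at hu
  have hu' := hu
  rw [orbit_minpoly] at hu
  obtain ⟨p, rfl⟩ := hu
  have hint : IsIntegral K ((p • γ : regPts G L) : L) := Algebra.IsIntegral.isIntegral _
  rw [eq_of_monic_of_associated htm (minpoly.monic hint)
    (hti.associated_of_dvd (minpoly.irreducible hint) htu)]
  exact hu'

lemma dvd_prod_orbit (γ : regPts G L) {t : K[X]} (ht : t ∈ orbit G (minpoly K (γ : L))) :
    t ∣ ∏ᶠ t ∈ orbit G (minpoly K (γ : L)), t := by
  have hfin := finite_orbit_minpoly γ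
  rw [finprod_mem_eq_finite_toFinset_prod _ hfin]
  exact Finset.dvd_prod_of_mem _ (hfin.mem_toFinset.2 ht)

lemma ncard_orbit_pos (γ : regPts G L) : 0 < (orbit G (minpoly K (γ : L))).ncard :=
  (Set.ncard_pos (finite_orbit_minpoly γ)).2 ⟨_, minpoly_mem_orbit_self γ⟩

lemma natDegree_prod_orbit_pos (γ : regPts G L) :
    0 < (∏ᶠ t ∈ orbit G (minpoly K (γ : L)), t).natDegree := by
  rw [natDegree_prod_orbit]
  exact Nat.mul_pos (ncard_orbit_pos γ) (minpoly.natDegree_pos (Algebra.IsIntegral.isIntegral _))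

end Orbit

/-! ### Degrees and ramification -/

section Transform
variable {G : Subgroup PGL(2, K)} {g h : K[X]}

lemma IsQuotientMap.natDegree_ratTransform (hQ : IsQuotientMap G g h) {F : K[X]} (hF : F.Monic) :
    (ratTransform F g h).natDegree = F.natDegree * Nat.card G := by
  set L := AlgebraicClosure K
  have hhL : h.map (algebraMap K L) ≠ 0 := by
    simpa [Polynomial.map_eq_zero] using hQ.den_ne_zero
  have hs := (IsAlgClosed.splits (F.map (algebraMap K L))).eq_prod_roots_of_monic
    (hF.map (algebraMap K L))
  rw [← natDegree_map (algebraMap K L), ratTransform_map, hs, ratTransform_multiset_prod _ _ _ hhL,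
    natDegree_multiset_prod_of_monic, Multiset.map_map]
  · have hn : (natDegree ∘ fun a : L => g.map (algebraMap K L) - C a * h.map (algebraMap K L)) =
        fun _ => Nat.card G := funext fun a => by
      rw [Function.comp_apply, (monic_sub_C_mul (hQ.monic.map _) (by
        rw [natDegree_map, natDegree_map]; exact hQ.natDegree_den) a).2, natDegree_map,
        hQ.natDegree_num]
    rw [hn, Multiset.map_const', Multiset.sum_replicate,
      smul_eq_mul, splits_iff_card_roots.1 (IsAlgClosed.splits (F.map (algebraMap K L))),
      natDegree_map]
  · intro p hp
    obtain ⟨a, -, rfl⟩ := Multiset.mem_map.1 hp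
    exact hQ.monic_sub a

variable {L : Type*} [Field L] [Algebra K L] [IsAlgClosed L] [Finite G]

/-- A quotient map takes every finite value outside the orbit of infinity. -/
lemma IsQuotientMap.exists_quotVal_eq (hQ : IsQuotientMap G g h) (β : L) :
    ∃ γ : regPts G L, quotVal g h (γ : L) = β := by
  have hM := monic_sub_C_mul (hQ.monic.map (algebraMap K L)) (h := h.map (algebraMap K L)) (by
    rw [natDegree_map, natDegree_map]; exact hQ.natDegree_den) β
  have hpos : 0 < Nat.card G := Nat.card_pos
  obtain ⟨γ, hγ⟩ := IsAlgClosed.exists_root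
    (g.map (algebraMap K L) - C β * h.map (algebraMap K L)) (by
      rw [degree_eq_natDegree hM.1.ne_zero, hM.2, natDegree_map, hQ.natDegree_num]
      exact_mod_cast hpos.ne')
  obtain ⟨h1, h2⟩ := hQ.quotVal_eq_of_isRoot hγ
  exact ⟨⟨γ, h1⟩, h2⟩

lemma IsQuotientMap.exists_minpoly_quotVal (hQ : IsQuotientMap G g h) (L : Type*) [Field L]
    [Algebra K L] [IsAlgClosed L] {F : K[X]} (hm : F.Monic) (hi : Irreducible F) :
    ∃ γ : regPts G L, F = minpoly K (quotVal g h (γ : L)) := by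
  obtain ⟨β, hβ⟩ := IsAlgClosed.exists_aeval_eq_zero L F (degree_pos_of_irreducible hi).ne'
  obtain ⟨γ, hγ⟩ := hQ.exists_quotVal_eq β
  exact ⟨γ, by rw [hγ]; exact minpoly.eq_of_irreducible_of_monic hi hβ hm⟩

variable [Normal K L] [Algebra.IsSeparable K L]

/-- The degrees of the two sides of `IsQuotientMap.ratTransform_minpoly`. -/
lemma IsQuotientMap.natDegree_mul_card (hQ : IsQuotientMap G g h) (γ : regPts G L) :
    (minpoly K (quotVal g h (γ : L))).natDegree * Nat.card G =
      Nat.card (MulAction.stabilizer G γ) * ((orbit G (minpoly K (γ : L))).ncard *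
        (minpoly K (γ : L)).natDegree) := by
  rw [← hQ.natDegree_ratTransform (minpoly.monic (Algebra.IsIntegral.isIntegral _)),
    hQ.ratTransform_minpoly, natDegree_pow, natDegree_prod_orbit]

lemma IsQuotientMap.mem_orbit_iff_dvd (hQ : IsQuotientMap G g h) (γ : regPts G L) {t : K[X]} :
    t ∈ orbit G (minpoly K (γ : L)) ↔ t.Monic ∧ Irreducible t ∧
      t ∣ ratTransform (minpoly K (quotVal g h (γ : L))) g h := by
  rw [hQ.ratTransform_minpoly]
  constructor
  · intro ht
    have ht' := ht
    rw [orbit_minpoly] at ht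
    obtain ⟨p, rfl⟩ := ht
    have hint : IsIntegral K ((p • γ : regPts G L) : L) := Algebra.IsIntegral.isIntegral _
    exact ⟨minpoly.monic hint, minpoly.irreducible hint,
      (dvd_prod_orbit γ ht').trans (dvd_pow_self _ Nat.card_pos.ne')⟩
  · rintro ⟨h1, h2, h3⟩
    exact mem_orbit_of_dvd γ h1 h2 h3

/-- If the transform is a proper power of an orbit product then the exponent is the order of a
stabilizer. -/
lemma IsQuotientMap.one_lt_card_stabilizer (hQ : IsQuotientMap G g h) {γ δ : regPts G L} {k : ℕ}
    (hk : 1 < k) (heq : ratTransform (minpoly K (quotVal g h (δ : L))) g h =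
      (∏ᶠ t ∈ orbit G (minpoly K (γ : L)), t) ^ k) :
    1 < Nat.card (MulAction.stabilizer G δ) := by
  have h1 : minpoly K (δ : L) ∈ orbit G (minpoly K (γ : L)) := by
    have := (hQ.mem_orbit_iff_dvd δ).1 (minpoly_mem_orbit_self δ)
    rw [heq] at this
    exact mem_orbit_of_dvd γ this.1 this.2.1 this.2.2
  rw [hQ.ratTransform_minpoly, orbit_eq_of_mem h1] at heq
  have := congrArg natDegree heq
  rw [natDegree_pow, natDegree_pow] at this
  rwa [Nat.eq_of_mul_eq_mul_right (natDegree_prod_orbit_pos γ) this]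

omit [IsAlgClosed L] [Finite G] [Normal K L] [Algebra.IsSeparable K L] in
lemma aeval_fixPoly_of_smul_eq {p : G} {γ : regPts G L} (hp : p • γ = γ) :
    aeval (γ : L) (fixPoly (rep (p : PGL(2, K)))) = 0 :=
  (aeval_fixPoly_eq_zero_iff _ (γ.2 _ (by rw [mk_rep]; exact p.2))).2 (congrArg Subtype.val hp)

omit [IsAlgClosed L] [Normal K L] [Algebra.IsSeparable K L] in
/-- Only finitely many points have a nontrivial stabilizer. -/
lemma finite_ramified (G : Subgroup PGL(2, K)) [Finite G] :
    {γ : regPts G L | 1 < Nat.card (MulAction.stabilizer G γ)}.Finite := by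
  have hfin : (⋃ p ∈ {p : G | p ≠ 1}, (fixPoly (rep (p : PGL(2, K)))).rootSet L).Finite :=
    (Set.toFinite _).biUnion fun p _ => rootSet_finite _ _
  refine (hfin.preimage (f := fun γ : regPts G L => (γ : L))
    Subtype.val_injective.injOn).subset fun γ hγ => ?_
  have : Nontrivial (MulAction.stabilizer G γ) := Finite.one_lt_card_iff_nontrivial.1 hγ
  obtain ⟨⟨p, hp⟩, hne⟩ := exists_ne (1 : MulAction.stabilizer G γ)
  have hp1 : p ≠ 1 := fun h1 => hne (Subtype.ext h1)
  refine Set.mem_biUnion (x := p) hp1 ((mem_rootSet).2 ⟨fun h0 => hp1 (Subtype.ext ?_),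
    aeval_fixPoly_of_smul_eq hp⟩)
  have := mk_eq_one_of_fixPoly_eq_zero h0
  rwa [mk_rep] at this

/-- The set whose supremum defines `dQuot` is bounded, so that the degree over a point with
nontrivial stabilizer is at most `dQuot`. -/
lemma IsQuotientMap.natDegree_le_dQuot (hQ : IsQuotientMap G g h) (γ : regPts G L)
    (hγ : 1 < Nat.card (MulAction.stabilizer G γ)) :
    (minpoly K (quotVal g h (γ : L))).natDegree ≤ dQuot G g h := by
  refine le_csSup ?_ ?_
  · refine (((finite_ramified (L := L) G).image fun δ : regPts G L =>
      (minpoly K (quotVal g h (δ : L))).natDegree).subset ?_).bddAbove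
    rintro n ⟨F, ⟨hFm, hFi, hFn⟩, r, hr, k, hk, heq⟩
    obtain ⟨δ, hδ⟩ := hQ.exists_minpoly_quotVal L hFm hFi
    obtain ⟨ε, rfl⟩ := exists_regPts_of_mem_irrNR (L := L) hr
    exact ⟨δ, hQ.one_lt_card_stabilizer hk (hδ ▸ heq), by rw [← hFn, hδ]⟩
  · have hint : IsIntegral K (quotVal g h (γ : L)) := Algebra.IsIntegral.isIntegral _
    exact ⟨_, ⟨minpoly.monic hint, minpoly.irreducible hint, rfl⟩, _, minpoly_mem_irrNR γ, _, hγ,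
      hQ.ratTransform_minpoly γ⟩

end Transform

/-! ### The orbit of infinity -/

section Infinity
variable {G : Subgroup PGL(2, K)}

lemma ratTransform_C_mul (f g h : K[X]) (u : K) :
    ratTransform f (C u * g) (C u * h) = C (u ^ f.natDegree) * ratTransform f g h := by
  rw [ratTransform, ratTransform, Finset.mul_sum]
  refine Finset.sum_congr rfl fun i hi => ?_
  have hi' : i ≤ f.natDegree := Nat.lt_succ_iff.1 (Finset.mem_range.1 hi)
  rw [← Nat.add_sub_cancel' hi', pow_add u, mul_pow, mul_pow, C_mul, C_pow, C_pow,
    Nat.add_sub_cancel_left]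
  ring

lemma starAct_congr {A B : GL (Fin 2) K}
    (hAB : Matrix.ProjGenLinGroup.mk A = Matrix.ProjGenLinGroup.mk B) (f : K[X]) :
    starAct A f = starAct B f := by
  obtain ⟨u, rfl⟩ := Matrix.ProjGenLinGroup.mk_eq_mk_iff.1 hAB
  have hu : (u : K) ^ f.natDegree ≠ 0 := pow_ne_zero _ u.ne_zero
  rw [starAct, starAct, mobNum_mul_scalar, mobDen_mul_scalar, ratTransform_C_mul,
    leadingCoeff_mul, leadingCoeff_C, mul_inv_rev, ← mul_assoc, ← C_mul, mul_assoc _ _ (_ ^ _),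
    inv_mul_cancel₀ hu, mul_one]

lemma orbit_eq_range (r : K[X]) :
    orbit G r = Set.range fun p : G => starAct (rep (p : PGL(2, K))) r := by
  ext t
  constructor
  · rintro ⟨A, hA, rfl⟩
    exact ⟨⟨_, hA⟩, starAct_congr (mk_rep _) r⟩
  · rintro ⟨p, rfl⟩
    exact ⟨_, by rw [mk_rep]; exact p.2, rfl⟩

/-- The transform of `x - A∞` by `A` is the constant `1`. -/
lemma starAct_X_sub_C {A : GL (Fin 2) K} (hc : A 1 0 ≠ 0) :
    starAct A (X - C (A 0 0 / A 1 0)) = 1 := by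
  have h1 : ratTransform (X - C (A 0 0 / A 1 0)) (mobNum A) (mobDen A) =
      C (A 0 1 - A 0 0 / A 1 0 * A 1 1) := by
    have h2 := ratTransform_multiset_prod {A 0 0 / A 1 0} (mobNum A) (mobDen A) (mobDen_ne_zero A)
    simp only [Multiset.map_singleton, Multiset.prod_singleton] at h2
    rw [h2, mobNum, mobDen, mul_add, ← mul_assoc, ← C_mul, div_mul_cancel₀ _ hc, C_sub, C_mul]
    ring
  have h3 : A 0 1 - A 0 0 / A 1 0 * A 1 1 ≠ 0 := by
    intro h0
    apply det_ne_zero A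
    field_simp at h0
    linear_combination -h0
  rw [starAct, h1, leadingCoeff_C, ← C_mul, inv_mul_cancel₀ h3, C_1]

/-- If the orbit of `x - A∞`, in which `1` takes the place of the point at infinity, has `|G|` members,
then only the identity of `G` fixes infinity: `[A]` and `[A C₀]` both send `x - A∞` to `1`. -/
lemma mk_eq_one_of_fix_infty [Finite G] {A C₀ : GL (Fin 2) K} (hc : A 1 0 ≠ 0)
    (hA : Matrix.ProjGenLinGroup.mk A ∈ G) (hC : Matrix.ProjGenLinGroup.mk C₀ ∈ G)
    (hC0 : C₀ 1 0 = 0)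
    (hcard : (orbit G (X - C (A 0 0 / A 1 0))).ncard = Nat.card G) :
    Matrix.ProjGenLinGroup.mk C₀ = 1 := by
  set r := X - C (A 0 0 / A 1 0)
  rw [orbit_eq_range, Set.ncard, Set.encard, ENat.card] at hcard
  have hbij : Function.Bijective
      (Set.rangeFactorization fun p : G => starAct (rep (p : PGL(2, K))) r) :=
    Set.rangeFactorization_surjective.bijective_of_nat_card_le hcard.ge
  have hd : C₀ 0 0 ≠ 0 := fun h0 => det_ne_zero C₀ (by simp [h0, hC0])
  have e0 : (A * C₀) 0 0 = A 0 0 * C₀ 0 0 := by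
    simp [Units.val_mul, Matrix.mul_apply, Fin.sum_univ_two, hC0]
  have e1 : (A * C₀) 1 0 = A 1 0 * C₀ 0 0 := by
    simp [Units.val_mul, Matrix.mul_apply, Fin.sum_univ_two, hC0]
  have hr : r = X - C ((A * C₀) 0 0 / (A * C₀) 1 0) := by
    rw [e0, e1, mul_div_mul_right _ _ hd]
  have hAC : Matrix.ProjGenLinGroup.mk (A * C₀) ∈ G := by rw [map_mul]; exact G.mul_mem hA hC
  have heq : (⟨_, hA⟩ : G) = ⟨_, hAC⟩ := by
    apply hbij.1
    apply Subtype.ext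
    change starAct (rep (Matrix.ProjGenLinGroup.mk A)) r =
      starAct (rep (Matrix.ProjGenLinGroup.mk (A * C₀))) r
    rw [starAct_congr (mk_rep _), starAct_congr (mk_rep _), starAct_X_sub_C hc, hr,
      starAct_X_sub_C (by rw [e1]; exact mul_ne_zero hc hd)]
  have := congrArg Subtype.val heq
  simpa using this

variable {L : Type*} [Field L] [Algebra K L]

lemma aeval_mobDen_mul' (A B : GL (Fin 2) K) (γ : L) : aeval γ (mobDen (A * B)) =
    algebraMap K L (A 1 0) * aeval γ (mobNum B) + algebraMap K L (A 1 1) * aeval γ (mobDen B) := by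
  simp only [aeval_mobDen, aeval_mobNum, Units.val_mul, Matrix.mul_apply, Fin.sum_univ_two,
    map_add, map_mul]
  ring

/-- If the orbit of infinity is regular and contains a finite point, then some point outside it
has a nontrivial stabilizer. -/
lemma exists_ramified_of_infty_regular [IsAlgClosed L] [Finite G] {A : GL (Fin 2) K}
    (hc : A 1 0 ≠ 0) (hA : Matrix.ProjGenLinGroup.mk A ∈ G)
    (hcard : (orbit G (X - C (A 0 0 / A 1 0))).ncard = Nat.card G) :
    ∃ γ : regPts G L, 1 < Nat.card (MulAction.stabilizer G γ) := by
  have hA1 : Matrix.ProjGenLinGroup.mk A ≠ 1 := by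
    intro h1
    rw [← map_one Matrix.ProjGenLinGroup.mk, eq_comm] at h1
    obtain ⟨u, rfl⟩ := Matrix.ProjGenLinGroup.mk_eq_mk_iff.1 h1
    simp at hc
  have hdeg : (fixPoly A).degree = 2 := degree_quadratic hc
  obtain ⟨γ, hγ⟩ := IsAlgClosed.exists_aeval_eq_zero L (fixPoly A) (by rw [hdeg]; decide)
  have hden : aeval γ (mobDen A) ≠ 0 := by
    intro h0
    apply aeval_mobNum_ne_zero A h0
    rw [aeval_mobNum]
    rw [aeval_mobDen] at h0
    simp only [fixPoly, map_add, map_mul, aeval_C, map_pow, aeval_X, map_sub, map_neg] at hγ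
    linear_combination γ * h0 - hγ
  have hfix := (aeval_fixPoly_eq_zero_iff A hden).1 hγ
  -- if `B` sent `γ` to infinity, then `B A B⁻¹` would be a nontrivial element fixing infinity
  have hreg : γ ∈ regPts G L := by
    intro B hB h0
    have hBA : aeval γ (mobDen (B * A)) = 0 := by
      rw [aeval_mobDen_mul _ _ hden, hfix, h0, zero_mul]
    have hC : Matrix.ProjGenLinGroup.mk (B * A * B⁻¹) ∈ G := by
      rw [map_mul, map_mul, map_inv]
      exact G.mul_mem (G.mul_mem hB hA) (G.inv_mem hB)
    have hC0 : (B * A * B⁻¹) 1 0 = 0 := by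
      have := aeval_mobDen_mul' (B * A * B⁻¹) B γ
      rw [inv_mul_cancel_right, hBA, h0, mul_zero, add_zero, eq_comm, mul_eq_zero,
        map_eq_zero] at this
      exact this.resolve_right (aeval_mobNum_ne_zero B h0)
    have := mk_eq_one_of_fix_infty hc hA hC hC0 hcard
    rw [map_mul, map_mul, map_inv, conj_eq_one_iff] at this
    exact hA1 this
  refine ⟨⟨γ, hreg⟩, Finite.one_lt_card_iff_nontrivial.2 ?_⟩
  refine ⟨⟨⟨_, hA⟩, ?_⟩, 1, fun h1 => hA1 ?_⟩
  · rw [MulAction.mem_stabilizer_iff]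
    exact Subtype.ext ((coe_mk_smul hA _).trans hfix)
  · simpa using congrArg (fun x : MulAction.stabilizer G (⟨γ, hreg⟩ : regPts G L) => ((x : G) : PGL(2, K))) h1

end Infinity

/-! ### The bijection between polynomials and orbits -/

section Count
variable [Finite K]

lemma finite_irr (m : ℕ) : (irr K m).Finite := by
  have : Finite (degreeLT K (m + 1)) := Module.finite_of_finite K
  refine (Set.toFinite ((degreeLT K (m + 1) : Submodule K K[X]) : Set K[X])).subset ?_
  rintro f ⟨hm, -, hn⟩
  rw [SetLike.mem_coe, mem_degreeLT, degree_eq_natDegree hm.ne_zero, hn]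
  exact_mod_cast Nat.lt_succ_self m

variable (G : Subgroup PGL(2, K)) {g h : K[X]}

instance : Finite PGL(2, K) := Finite.of_surjective _ Matrix.ProjGenLinGroup.mk_surjective

/-- As quotient maps exist, the infimum defining `dGroup` is attained by one of them. -/
lemma exists_isQuotientMap_dGroup : ∃ g h : K[X], IsQuotientMap G g h ∧ dGroup G = dQuot G g h := by
  obtain ⟨g, h, hQ⟩ := exists_isQuotientMap G
  exact Nat.sInf_mem (s := {n | ∃ g h : K[X], IsQuotientMap G g h ∧ n = dQuot G g h})
    ⟨_, g, h, hQ, rfl⟩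

variable {G}

/-- The set of monic irreducible factors of a polynomial. -/
def irrFactors (P : K[X]) : Set K[X] := {t | t.Monic ∧ Irreducible t ∧ t ∣ P}

lemma IsQuotientMap.irrFactors_eq {L : Type*} [Field L] [Algebra K L] [Normal K L] [IsAlgClosed L]
    [Algebra.IsSeparable K L] (hQ : IsQuotientMap G g h) (γ : regPts G L) :
    irrFactors (ratTransform (minpoly K (quotVal g h (γ : L))) g h) =
      orbit G (minpoly K (γ : L)) :=
  Set.ext fun _ => (hQ.mem_orbit_iff_dvd γ).symm

lemma IsQuotientMap.injOn_irrFactors (hQ : IsQuotientMap G g h) (m : ℕ) :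
    Set.InjOn (fun F => irrFactors (ratTransform F g h)) (irr K m) := by
  rintro F ⟨hFm, hFi, -⟩ F' ⟨hFm', hFi', -⟩ heq
  obtain ⟨γ, rfl⟩ := hQ.exists_minpoly_quotVal (AlgebraicClosure K) hFm hFi
  obtain ⟨δ, rfl⟩ := hQ.exists_minpoly_quotVal (AlgebraicClosure K) hFm' hFi'
  simp only [hQ.irrFactors_eq] at heq
  rw [← hQ.minpoly_mem_orbit_iff δ γ, ← heq]
  exact minpoly_mem_orbit_self γ

/-- The orbits counted by `omega G (m * (|G| / k)) k`. -/
def orbitSet (G : Subgroup PGL(2, K)) (m k : ℕ) : Set (Set K[X]) :=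
  {O | (∃ r ∈ irr K (m * (Nat.card G / k)), O = orbit G r) ∧ O.ncard = k}

/-- No polynomial with a root in the orbit of infinity is counted when `m` exceeds `dQuot`. -/
lemma IsQuotientMap.mem_irrNR_of_dQuot_lt (hQ : IsQuotientMap G g h) {m : ℕ}
    (hm : dQuot G g h < m) {k : ℕ} (hk : k ∣ Nat.card G) {r : K[X]}
    (hr : r ∈ irr K (m * (Nat.card G / k))) (hcard : (orbit G r).ncard = k) : r ∈ irrNR G := by
  obtain ⟨hrm, hri, hrn⟩ := hr
  refine ⟨hrm, hri, fun A hA hc h0 => ?_⟩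
  have hX := eq_X_sub_C_of_eval_eq_zero hrm hri h0
  -- `r` is linear, so that `m = 1` and `k = |G|`
  rw [hX, natDegree_X_sub_C, eq_comm, mul_eq_one] at hrn
  have hkn : k = Nat.card G := (Nat.eq_of_dvd_of_div_eq_one hk hrn.2)
  rw [hX, hkn] at hcard
  obtain ⟨γ, hγ⟩ := exists_ramified_of_infty_regular (L := AlgebraicClosure K) hc hA hcard
  have h1 := hQ.natDegree_le_dQuot γ hγ
  have h2 := minpoly.natDegree_pos (A := K)
    (Algebra.IsIntegral.isIntegral (R := K) (quotVal g h (γ : AlgebraicClosure K)))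
  omega

lemma IsQuotientMap.image_irrFactors (hQ : IsQuotientMap G g h) {m : ℕ} (hm : dQuot G g h < m) :
    (fun F => irrFactors (ratTransform F g h)) '' irr K m =
      ⋃ k ∈ (Nat.card G).divisors, orbitSet G m k := by
  have hpos : 0 < Nat.card G := Nat.card_pos
  ext O
  simp only [Set.mem_image, Set.mem_iUnion, Nat.mem_divisors, exists_prop]
  constructor
  · rintro ⟨F, ⟨hFm, hFi, hFn⟩, rfl⟩
    obtain ⟨γ, rfl⟩ := hQ.exists_minpoly_quotVal (AlgebraicClosure K) hFm hFi
    rw [hQ.irrFactors_eq]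
    have hdvd := ncard_orbit_minpoly_dvd γ
    refine ⟨_, ⟨hdvd, hpos.ne'⟩, ⟨_, ⟨minpoly.monic (Algebra.IsIntegral.isIntegral _),
      minpoly.irreducible (Algebra.IsIntegral.isIntegral _), ?_⟩, rfl⟩, rfl⟩
    -- a nontrivial stabilizer would give `m ≤ dQuot`
    have hs : Nat.card (MulAction.stabilizer G γ) = 1 := by
      by_contra hne
      have h1 : 0 < Nat.card (MulAction.stabilizer G γ) := Nat.card_pos
      have := hQ.natDegree_le_dQuot γ (by omega)
      omega
    have hdeg := hQ.natDegree_mul_card γ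
    rw [hFn, hs, one_mul] at hdeg
    rw [← Nat.mul_div_assoc _ hdvd, hdeg, Nat.mul_div_cancel_left _ (ncard_orbit_pos γ)]
  · rintro ⟨k, ⟨hk, -⟩, ⟨r, hr, rfl⟩, hcard⟩
    obtain ⟨γ, hγ⟩ := exists_regPts_of_mem_irrNR (L := AlgebraicClosure K)
      (hQ.mem_irrNR_of_dQuot_lt hm hk hr hcard)
    subst hγ
    have hint : IsIntegral K (quotVal g h (γ : AlgebraicClosure K)) :=
      Algebra.IsIntegral.isIntegral _
    refine ⟨minpoly K (quotVal g h (γ : AlgebraicClosure K)),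
      ⟨minpoly.monic hint, minpoly.irreducible hint, ?_⟩, hQ.irrFactors_eq γ⟩
    have hdeg := hQ.natDegree_mul_card γ
    rw [hcard, hr.2.2, mul_left_comm k, Nat.mul_div_cancel' hk, ← mul_assoc] at hdeg
    -- now `deg F = |Stab γ| * m`, and this exceeds `dQuot` already if the stabilizer is trivial
    have hdeg' := Nat.eq_of_mul_eq_mul_right hpos hdeg
    have hs0 : 0 < Nat.card (MulAction.stabilizer G γ) := Nat.card_pos
    rcases Nat.lt_or_ge 1 (Nat.card (MulAction.stabilizer G γ)) with h1 | h1
    · have := hQ.natDegree_le_dQuot γ h1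
      nlinarith
    · rw [hdeg', le_antisymm h1 hs0, one_mul]

end Count

end MobiusOrbits

end

theorem theorem4 {K : Type*} [Field K] [Finite K] (G : Subgroup PGL(2, K)) (m : ℕ)
    (hm : MobiusOrbits.dGroup G < m) :
    MobiusOrbits.numIrr K m =
      ∑ k ∈ (Nat.card G).divisors, MobiusOrbits.omega G (m * (Nat.card G / k)) k := by
  obtain ⟨g, h, hQ, hd⟩ := MobiusOrbits.exists_isQuotientMap_dGroup G
  rw [hd] at hm
  have himage := hQ.image_irrFactors hm
  have hfin := (MobiusOrbits.finite_irr (K := K) m).image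
    fun F => MobiusOrbits.irrFactors (MobiusOrbits.ratTransform F g h)
  rw [himage] at hfin
  rw [MobiusOrbits.numIrr, ← (hQ.injOn_irrFactors m).ncard_image, himage]
  have hfink : ∀ k ∈ (Nat.card G).divisors, (MobiusOrbits.orbitSet G m k).Finite := fun k hk =>
    hfin.subset (Set.subset_biUnion_of_mem (u := fun k => MobiusOrbits.orbitSet G m k) hk)
  have hdisj : ((Nat.card G).divisors : Set ℕ).PairwiseDisjoint (MobiusOrbits.orbitSet G m) :=
    fun k _ l _ hkl => Set.disjoint_left.2 fun O hk hl => hkl (hk.2.symm.trans hl.2)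
  have := Set.Finite.ncard_biUnion (Finset.finite_toSet (Nat.card G).divisors) hfink hdisj
  rw [finsum_mem_coe_finset] at this
  exact this
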